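/- Let $T\ge 0$, let $(\Omega,\mathscr F,\mathbb Q^T)$ be a probability space ($\mathbb Q^T$ being the $T$-forward measure, with expectation $\mathbb E^T$), let $W_1,W_2,W_3$ be real-valued processes on $[0,T]$ (for instance Brownian motions), and let $X=\{X(s):0\le s\le T\}$ be a process with right-continuous paths and values in the set $\{e_1,\dots,e_N\}$ of unit vectors of $\mathbb R^N$. Write $\mathscr F_i(s)$ and $\mathscr F_X(s)$ for the $\sigma$-algebras generated by $\{W_i(u):0\le u\le s\}$ and $\{X(u):0\le u\le s\}$, and $\mathscr G(s)=\mathscr F_1(s)\vee\mathscr F_2(s)\vee\mathscr F_3(s)\vee\mathscr F_X(s)$. Suppose that $$X(s)=X(0)+\int_0^s Q^T(u)X(u)\,du+M^T(s)\quad\text{a.s.},\qquad 0\le s\le T,$$ where $Q^T:[0,T]\to\mathbb R^{N\times N}$ has integrable entries (in particular $Q^T$ may be any continuous time-dependent rate matrix), and where the $\mathbb R^N$-valued process $M^T$ is a martingale with respect to $(\mathscr G(s))_{0\le s\le T}$, or else is a martingale with respect to $(\mathscr F_X(s))_{0\le s\le T}$ while $(W_1,W_2,W_3)$ is independent of $X$.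 Let $J:[0,T]\to\mathbb R^N$ have integrable entries, let $0\le t\le T$, and put $A(s)=Q^T(s)+\operatorname{diag}J(s)$. Let $$\Phi(t,s;J)=\sum_{n\ge 0}D_n(s),\qquad D_0(s)=I_N,\qquad D_{n+1}(s)=\int_t^s A(u)D_n(u)\,du,$$ be the time-ordered exponential of $\int_t^s A(u)\,du$ (later times to the left). Then: (1) The series converges for every $s\in[t,T]$, and $\Phi(t,\cdot;J)$ is the unique continuous solution on $[t,T]$ of the linear matrix ODE $\frac{d}{ds}\Phi(t,s;J)=A(s)\Phi(t,s;J)$, $\Phi(t,t;J)=I_N$, understood as the integral equation $\Phi(t,s;J)=I_N+\int_t^sA(u)\Phi(t,u;J)\,du$. The differential equation holds in the classical sense at every point of $[t,T]$ where $A|_{[t,T]}$ is continuous. (2) If $A(s)A(u)=A(u)A(s)$ for all $s,u\in[t,T]$, then $\Phi(t,T;J)=\exp\left(\int_t^T\left(Q^T(s)+\operatorname{diag}J(s)\right)ds\right)$. (3) The random variable $\exp\left(\int_t^T\langle J(s),X(s)\rangle\,ds\right)$ is integrable, and almost surely $$\mathbb E^T\left(\exp\left(\int_t^T\langle J(s),X(s)\rangle\,ds\right)\Big|\,\mathscr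 F_1(t)\vee\mathscr F_2(t)\vee\mathscr F_3(t)\vee\mathscr F_X(t)\right)=\langle\Phi(t,T;J)X(t),\mathbf 1\rangle,\qquad \mathbf 1=(1,\dots,1).$$ -/

import Mathlib

open MeasureTheory ProbabilityTheory
open scoped Matrix

/-- The terms of the Dyson series of the matrix function `A` started at time `t`:
`D₀(s) = I` and `Dₙ₊₁(s) = ∫ₜˢ A(u) Dₙ(u) du` (integrals of matrices are taken entrywise). -/
noncomputable def dysonTerm {N : ℕ} (A : ℝ → Matrix (Fin N) (Fin N) ℝ) (t : ℝ) :
    ℕ → ℝ → Matrix (Fin N) (Fin N) ℝ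
  | 0, _ => 1
  | n + 1, s => Matrix.of fun i j => ∫ u in t..s, (A u * dysonTerm A t n u) i j

/-- The time-ordered exponential of `∫ₜˢ A(u) du` (later times to the left), as the sum of the
Dyson series. -/
noncomputable def timeOrderedExp {N : ℕ} (A : ℝ → Matrix (Fin N) (Fin N) ℝ) (t s : ℝ) :
    Matrix (Fin N) (Fin N) ℝ :=
  ∑' n, dysonTerm A t n s

/-- `Φ` is the (Carathéodory) solution on `[t, T]` of the linear matrix initial value problem
`dΦ/ds = A(s) Φ(s)`, `Φ(t) = I`, written as an integral equation. -/
structure IsFundamentalSolution {N : ℕ} (A : ℝ → Matrix (Fin N) (Fin N) ℝ) (t T : ℝ)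
    (Φ : ℝ → Matrix (Fin N) (Fin N) ℝ) : Prop where
  continuousOn : ContinuousOn Φ (Set.Icc t T)
  integral_eq : ∀ s ∈ Set.Icc t T, ∀ i j,
    Φ s i j = (1 : Matrix (Fin N) (Fin N) ℝ) i j + ∫ u in t..s, (A u * Φ u) i j

/-- The natural filtration, indexed by `[0, T]`, of a process `Y`: the `σ`-algebra at time `t` is
generated by `Y s`, `0 ≤ s ≤ t`. -/
noncomputable def naturalFiltration {Ω : Type*} {mΩ : MeasurableSpace Ω} {E : Type*}
    [NormedAddCommGroup E] [MeasurableSpace E] [BorelSpace E] (T : ℝ) (Y : ℝ → Ω → E)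
    (hY : ∀ s : Set.Icc (0 : ℝ) T, StronglyMeasurable (Y s)) :
    Filtration (Set.Icc (0 : ℝ) T) mΩ :=
  Filtration.natural (fun s : Set.Icc (0 : ℝ) T => Y s) hY

/-- The enlarged filtration `ℱ₁ ∨ ℱ₂ ∨ ℱ₃ ∨ ℱ_X` on `[0, T]` generated by the three driving
processes `W 0`, `W 1`, `W 2` and by the chain `X`. -/
noncomputable def enlargedFiltration {Ω : Type*} {mΩ : MeasurableSpace Ω} {N : ℕ} (T : ℝ)
    (W : Fin 3 → ℝ → Ω → ℝ) (X : ℝ → Ω → Fin N → ℝ)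
    (hW : ∀ i, ∀ s : Set.Icc (0 : ℝ) T, StronglyMeasurable (W i s))
    (hX : ∀ s : Set.Icc (0 : ℝ) T, StronglyMeasurable (X s)) :
    Filtration (Set.Icc (0 : ℝ) T) mΩ :=
  naturalFiltration T (W 0) (hW 0) ⊔ naturalFiltration T (W 1) (hW 1) ⊔
    naturalFiltration T (W 2) (hW 2) ⊔ naturalFiltration T X hX

/-!
The analytic half rests on one identity. For integrable `A` with values in a Banach algebra and
primitive `B` vanishing at `t`, the product rule (`integral_mul_integral_eq`, a form of Fubini's
theorem) gives `(n + 1) ∫ A Bⁿ = Bⁿ⁺¹` whenever the values of `A` commute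
(`integral_mul_primitive_pow`). Applied to `‖A‖`, it bounds the `n`-th Dyson term by `‖1‖ (∫ ‖A‖)ⁿ
/ n!`, so the series converges, may be integrated termwise, and solves the integral equation
(`tsum_dysonSeq_eq`); the same iteration shows that a bounded function `f` with `f = ∫ A f`
vanishes (`eq_zero_of_eq_integral`). Applied to a commuting `A`, it identifies the `n`-th term
with `Bⁿ / n!`. Matrices are carried to operators on `ℝᴺ` by `matrixToOperator`.

For the conditional expectation, put `E(s) = exp (∫ₜˢ ⟨J, X⟩)` and fix an event `B` of the
`σ`-algebra at time `t`. Integrating `E X` by parts along each path gives, besides the expected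
drift `(Q + diag J) E X` (here `⟨J, X⟩ X = diag(J) X` because `X` is a unit vector), only terms of
the form `H(u) (D(s) - D(u))`, where `D` is the compensated chain and `H(u)` is either `1`, with
`u = t`, or `E(u) ⟨J(u), X(u)⟩` (`exp_pathIntegral_mul_eq`). The weight `H(u)` is known at time
`u`, as right-continuity makes additive functionals of `X` adapted
(`stronglyMeasurable_filtration_pathIntegral`), so these terms have zero expectation on `B`. No
stochastic integral is needed. Hence `z(s) = 𝔼[1_B E(s) X(s)]` is a bounded solution of `z' = (Q +
diag J) z` (`integral_exp_pathIntegral_mul_eq`), so that `z(T) = Φ(t, T) z(t)`, and summing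
coordinates gives the formula tested on `B`. When the martingale property is known only in the
filtration of the chain, independence of the noises transfers it to the enlarged filtration
(`setIntegral_eq_zero_of_indep`).
-/

/-! ### Product rule for primitives and the Dyson series in a Banach algebra -/

section DysonSeries

variable {𝔸 : Type*} [NormedRing 𝔸] [NormedAlgebra ℝ 𝔸]

/-- The product rule `(FG)(s) = ∫ₜˢ (f G + F g)` for the primitives `F`, `G` vanishing at `t` of
integrable functions `f`, `g`: it is Fubini's theorem on the square `(t, s]²` cut along its
diagonal. -/
theorem integral_mul_integral_eq {f g : ℝ → 𝔸} (hf : Integrable f) (hg : Integrable g)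
    {t s : ℝ} (hts : t ≤ s) :
    (∫ u in t..s, f u) * (∫ u in t..s, g u) =
      (∫ u in t..s, f u * ∫ v in t..u, g v) + ∫ v in t..s, (∫ u in t..v, f u) * g v := by
  set ν := (volume : Measure ℝ).restrict (Set.Ioc t s) with hν
  have hfν : Integrable f ν := hf.restrict
  have hgν : Integrable g ν := hg.restrict
  have hprod : Integrable (fun p : ℝ × ℝ => f p.1 * g p.2) (ν.prod ν) := hfν.mul_prod hgν
  have hle : MeasurableSet {p : ℝ × ℝ | p.2 ≤ p.1} := measurableSet_le measurable_snd measurable_fst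
  have hsplit : (∫ u, f u ∂ν) * (∫ v, g v ∂ν) =
      (∫ p in {p : ℝ × ℝ | p.2 ≤ p.1}, f p.1 * g p.2 ∂(ν.prod ν)) +
        ∫ p in {p : ℝ × ℝ | p.2 ≤ p.1}ᶜ, f p.1 * g p.2 ∂(ν.prod ν) := by
    rw [integral_add_compl hle hprod, integral_prod _ hprod]
    rw [← integral_mul_const_of_integrable hfν]
    exact integral_congr_ae (ae_of_all _ fun u => (integral_const_mul_of_integrable hgν).symm)
  rw [intervalIntegral.integral_of_le hts, intervalIntegral.integral_of_le hts,
    intervalIntegral.integral_of_le hts, intervalIntegral.integral_of_le hts, hsplit,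
    ← integral_indicator hle, ← integral_indicator hle.compl,
    integral_prod _ (hprod.indicator hle), integral_prod_symm _ (hprod.indicator hle.compl)]
  congr 1
  · refine setIntegral_congr_fun measurableSet_Ioc fun u hu => ?_
    have h1 : (fun v => ({p : ℝ × ℝ | p.2 ≤ p.1}).indicator (fun p => f p.1 * g p.2) (u, v)) =
        (Set.Iic u).indicator fun v => f u * g v := by
      ext v; simp only [Set.indicator, Set.mem_ofPred_eq, Set.mem_Iic]
    simp only [h1]
    rw [integral_indicator measurableSet_Iic, hν, Measure.restrict_restrict measurableSet_Iic,
      intervalIntegral.integral_of_le hu.1.le,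
      show Set.Iic u ∩ Set.Ioc t s = Set.Ioc t u by
        ext v; simp only [Set.mem_inter_iff, Set.mem_Iic, Set.mem_Ioc]
        exact ⟨fun h => ⟨h.2.1, h.1⟩, fun h => ⟨h.2, h.1, h.2.trans hu.2⟩⟩]
    exact integral_const_mul_of_integrable hg.restrict
  · refine setIntegral_congr_fun measurableSet_Ioc fun v hv => ?_
    have h1 : (fun u => ({p : ℝ × ℝ | p.2 ≤ p.1}ᶜ).indicator (fun p => f p.1 * g p.2) (u, v)) =
        (Set.Iio v).indicator fun u => f u * g v := by
      ext u; simp only [Set.indicator, Set.mem_compl_iff, Set.mem_ofPred_eq, Set.mem_Iio, not_le]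
    simp only [h1]
    rw [integral_indicator measurableSet_Iio, hν, Measure.restrict_restrict measurableSet_Iio,
      intervalIntegral.integral_of_le hv.1.le, integral_Ioc_eq_integral_Ioo,
      show Set.Iio v ∩ Set.Ioc t s = Set.Ioo t v by
        ext u; simp only [Set.mem_inter_iff, Set.mem_Iio, Set.mem_Ioc, Set.mem_Ioo]
        exact ⟨fun h => ⟨h.2.1, h.1⟩, fun h => ⟨h.2, h.1, h.2.le.trans hv.2⟩⟩]
    exact integral_mul_const_of_integrable hf.restrict

theorem continuous_primitive_of_integrable {E : Type*} [NormedAddCommGroup E]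
    [NormedSpace ℝ E] {f : ℝ → E} (hf : Integrable f) (t : ℝ) :
    Continuous fun s => ∫ u in t..s, f u :=
  intervalIntegral.continuous_primitive (fun _ _ => hf.intervalIntegrable) t

theorem intervalIntegrable_mul_primitive_pow {A : ℝ → 𝔸} (hA : Integrable A) (t s : ℝ) (n : ℕ) :
    IntervalIntegrable (fun u => A u * (∫ v in t..u, A v) ^ n) volume t s :=
  hA.intervalIntegrable.mul_continuousOn
    ((continuous_primitive_of_integrable hA t).pow n).continuousOn

/-- If the values of `A` commute, then `(n + 1) ∫ A Bⁿ = Bⁿ⁺¹` for the primitive `B` of `A`.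
Besides the exponential formula in the commuting case, the case `𝔸 = ℝ` gives the bounds `aⁿ / n!`
behind convergence and uniqueness, and the integral equation of the exponential of a primitive. -/
theorem integral_mul_primitive_pow [CompleteSpace 𝔸] {A : ℝ → 𝔸} (hA : Integrable A) {t T : ℝ}
    (hcomm : ∀ u ∈ Set.Ioc t T, ∀ v ∈ Set.Ioc t T, Commute (A u) (A v)) (n : ℕ) :
    ∀ s ∈ Set.Icc t T,
      ((n : ℝ) + 1) • ∫ u in t..s, A u * (∫ v in t..u, A v) ^ n = (∫ v in t..s, A v) ^ (n + 1) := by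
  have hB : ∀ u ∈ Set.Ioc t T, Commute (A u) (∫ v in t..u, A v) := by
    intro u hu
    rw [intervalIntegral.integral_of_le hu.1.le]
    unfold Commute SemiconjBy
    rw [← integral_const_mul_of_integrable hA.restrict,
      ← integral_mul_const_of_integrable hA.restrict]
    exact setIntegral_congr_fun measurableSet_Ioc fun v hv =>
      (hcomm u hu v ⟨hv.1, hv.2.trans hu.2⟩).eq
  induction n with
  | zero => intro s hs; simp
  | succ n ih =>
    intro s hs
    set B : ℝ → 𝔸 := fun s => ∫ v in t..s, A v with hBdef
    have hBc : Continuous B := continuous_primitive_of_integrable hA t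
    -- the product rule applies to globally integrable functions, hence the truncation
    set g : ℝ → 𝔸 := (Set.Ioc t T).indicator fun u => A u * B u ^ n with hg
    have hgi : Integrable g := by
      rw [hg, integrable_indicator_iff measurableSet_Ioc]
      exact (intervalIntegrable_iff_integrableOn_Ioc_of_le (hs.1.trans hs.2)).1
        (intervalIntegrable_mul_primitive_pow hA t T n)
    have hgint : ∀ u ∈ Set.Icc t T, ((n : ℝ) + 1) • ∫ v in t..u, g v = B u ^ (n + 1) := by
      intro u hu
      rw [← ih u hu]
      congr 1
      refine intervalIntegral.integral_congr_ae (ae_of_all _ fun v hv => ?_)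
      rw [Set.uIoc_of_le hu.1] at hv
      exact Set.indicator_of_mem (show v ∈ Set.Ioc t T from ⟨hv.1, hv.2.trans hu.2⟩) _
    have hprod := integral_mul_integral_eq hA hgi hs.1
    have h1 : ∫ u in t..s, A u * ∫ v in t..u, g v =
        ((n : ℝ) + 1)⁻¹ • ∫ u in t..s, A u * B u ^ (n + 1) := by
      rw [← intervalIntegral.integral_smul]
      refine intervalIntegral.integral_congr fun u hu => ?_
      rw [Set.uIcc_of_le hs.1] at hu
      rw [← hgint u ⟨hu.1, hu.2.trans hs.2⟩, mul_smul_comm, inv_smul_smul₀ (by positivity)]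
    have h2 : ∫ u in t..s, B u * g u = ∫ u in t..s, A u * B u ^ (n + 1) := by
      refine intervalIntegral.integral_congr_ae (ae_of_all _ fun u hu => ?_)
      rw [Set.uIoc_of_le hs.1] at hu
      have hu' : u ∈ Set.Ioc t T := ⟨hu.1, hu.2.trans hs.2⟩
      rw [hg, Set.indicator_of_mem hu', ← mul_assoc, ← (hB u hu').eq, mul_assoc, pow_succ']
    rw [h1, h2] at hprod
    rw [pow_succ' (B s) (n + 1), ← hgint s hs, mul_smul_comm, hprod, smul_add,
      smul_inv_smul₀ (by positivity)]
    push_cast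
    module

/-- The terms of the Dyson series of `A` started at time `t`, in a normed algebra; the matrix
version `dysonTerm` uses entrywise integrals instead of the Bochner integral. -/
noncomputable def dysonSeq (A : ℝ → 𝔸) (t : ℝ) : ℕ → ℝ → 𝔸
  | 0, _ => 1
  | n + 1, s => ∫ u in t..s, A u * dysonSeq A t n u

theorem continuous_dysonSeq {A : ℝ → 𝔸} (hA : Integrable A) (t : ℝ) (n : ℕ) :
    Continuous (dysonSeq A t n) := by
  induction n with
  | zero => exact continuous_const
  | succ n ih =>
    exact intervalIntegral.continuous_primitive
      (fun a b => hA.intervalIntegrable.mul_continuousOn ih.continuousOn) t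

theorem integral_mul_primitive_pow_div_factorial {a : ℝ → ℝ} (ha : Integrable a)
    {t s : ℝ} (hts : t ≤ s) (n : ℕ) :
    ∫ u in t..s, a u * ((∫ v in t..u, a v) ^ n / n.factorial) =
      (∫ v in t..s, a v) ^ (n + 1) / (n + 1).factorial := by
  have h := integral_mul_primitive_pow ha (t := t) (T := s)
    (fun _ _ _ _ => Commute.all _ _) n s ⟨hts, le_rfl⟩
  rw [← h]
  simp_rw [← mul_div_assoc]
  rw [intervalIntegral.integral_div, Nat.factorial_succ]
  push_cast
  have : (n.factorial : ℝ) ≠ 0 := by positivity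
  have : (n : ℝ) + 1 ≠ 0 := by positivity
  rw [smul_eq_mul]
  field_simp

/-- An iterated Grönwall bound that needs no measurability of `f`: the recursive bound is
propagated through the hypothesis. -/
theorem norm_le_primitive_pow {E : Type*} [NormedAddCommGroup E] [NormedSpace ℝ E]
    {a : ℝ → ℝ} (ha : Integrable a) {t T C : ℝ} (f k : ℕ → ℝ → E)
    (h0 : ∀ u ∈ Set.Icc t T, ‖f 0 u‖ ≤ C)
    (hk : ∀ n, ∀ u ∈ Set.Icc t T, ‖k n u‖ ≤ a u * ‖f n u‖) (ha0 : ∀ u, 0 ≤ a u)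
    (hf : ∀ n, ∀ s ∈ Set.Icc t T, f (n + 1) s = ∫ u in t..s, k n u) (n : ℕ) :
    ∀ s ∈ Set.Icc t T, ‖f n s‖ ≤ C * ((∫ u in t..s, a u) ^ n / n.factorial) := by
  induction n with
  | zero => intro s hs; simpa using h0 s hs
  | succ n ih =>
    intro s hs
    rw [hf n s hs, ← integral_mul_primitive_pow_div_factorial ha hs.1,
      ← intervalIntegral.integral_const_mul]
    refine intervalIntegral.norm_integral_le_of_norm_le hs.1 (ae_of_all _ fun u hu => ?_) ?_
    · have hu' : u ∈ Set.Icc t T := ⟨hu.1.le, hu.2.trans hs.2⟩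
      calc ‖k n u‖ ≤ a u * ‖f n u‖ := hk n u hu'
        _ ≤ a u * (C * ((∫ v in t..u, a v) ^ n / n.factorial)) :=
          mul_le_mul_of_nonneg_left (ih u hu') (ha0 u)
        _ = _ := by ring
    · exact (ha.intervalIntegrable.mul_continuousOn
        (((continuous_primitive_of_integrable ha t).pow n).div_const _).continuousOn).const_mul C

/-- Uniqueness for linear integral equations with an integrable rate `a`, among bounded functions
with no regularity assumed. -/
theorem eq_zero_of_eq_integral {E : Type*} [NormedAddCommGroup E] [NormedSpace ℝ E]
    {a : ℝ → ℝ} (ha : Integrable a) {t T C : ℝ} (f k : ℝ → E)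
    (h0 : ∀ u ∈ Set.Icc t T, ‖f u‖ ≤ C)
    (hk : ∀ u ∈ Set.Icc t T, ‖k u‖ ≤ a u * ‖f u‖) (ha0 : ∀ u, 0 ≤ a u)
    (hf : ∀ s ∈ Set.Icc t T, f s = ∫ u in t..s, k u) {s : ℝ} (hs : s ∈ Set.Icc t T) : f s = 0 := by
  have h := fun n => norm_le_primitive_pow ha (fun _ => f) (fun _ => k) h0 (fun _ => hk) ha0
    (fun _ => hf) n s hs
  have hlim := (FloorSemiring.tendsto_pow_div_factorial_atTop (∫ u in t..s, a u)).const_mul C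
  rw [mul_zero] at hlim
  exact norm_le_zero_iff.1 (ge_of_tendsto' hlim h)

theorem norm_dysonSeq_le {A : ℝ → 𝔸} (hA : Integrable A) {t s : ℝ} (hts : t ≤ s) (n : ℕ) :
    ‖dysonSeq A t n s‖ ≤ ‖(1 : 𝔸)‖ * ((∫ u in t..s, ‖A u‖) ^ n / n.factorial) :=
  norm_le_primitive_pow hA.norm (dysonSeq A t) (fun n u => A u * dysonSeq A t n u)
    (fun _ _ => le_rfl) (fun _ _ _ => norm_mul_le _ _) (fun _ => norm_nonneg _)
    (fun _ _ _ => rfl) n s ⟨hts, le_rfl⟩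

theorem norm_dysonSeq_le_of_le {A : ℝ → 𝔸} (hA : Integrable A) {t s T : ℝ}
    (hs : s ∈ Set.Icc t T) (n : ℕ) :
    ‖dysonSeq A t n s‖ ≤ ‖(1 : 𝔸)‖ * ((∫ u in t..T, ‖A u‖) ^ n / n.factorial) := by
  refine (norm_dysonSeq_le hA hs.1 n).trans ?_
  have h0 : 0 ≤ ∫ u in t..s, ‖A u‖ :=
    intervalIntegral.integral_nonneg hs.1 fun _ _ => norm_nonneg _
  have h1 : ∫ u in t..s, ‖A u‖ ≤ ∫ u in t..T, ‖A u‖ :=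
    intervalIntegral.integral_mono_interval le_rfl hs.1 hs.2
      (ae_of_all _ fun _ => norm_nonneg _) hA.norm.intervalIntegrable
  gcongr

theorem summable_dysonSeq_bound (c x : ℝ) : Summable fun n : ℕ => c * (x ^ n / n.factorial) :=
  (Real.summable_pow_div_factorial x).mul_left c

theorem summable_dysonSeq [CompleteSpace 𝔸] {A : ℝ → 𝔸} (hA : Integrable A) {t s : ℝ}
    (hts : t ≤ s) :
    Summable fun n => dysonSeq A t n s :=
  Summable.of_norm_bounded (summable_dysonSeq_bound _ _) fun n => norm_dysonSeq_le hA hts n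

theorem continuousOn_tsum_dysonSeq [CompleteSpace 𝔸] {A : ℝ → 𝔸} (hA : Integrable A) (t T : ℝ) :
    ContinuousOn (fun s => ∑' n, dysonSeq A t n s) (Set.Icc t T) :=
  continuousOn_tsum (fun n => (continuous_dysonSeq hA t n).continuousOn)
    (summable_dysonSeq_bound _ _) fun n _ hs => norm_dysonSeq_le_of_le hA hs n

theorem tsum_dysonSeq_eq [CompleteSpace 𝔸] {A : ℝ → 𝔸} (hA : Integrable A) {t s : ℝ} (hts : t ≤ s) :
    ∑' n, dysonSeq A t n s = 1 + ∫ u in t..s, A u * ∑' n, dysonSeq A t n u := by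
  rw [(summable_dysonSeq hA hts).tsum_eq_zero_add]
  congr 1
  refine HasSum.tsum_eq ?_
  refine intervalIntegral.hasSum_integral_of_dominated_convergence
    (fun n u => ‖A u‖ * (‖(1 : 𝔸)‖ * ((∫ v in t..s, ‖A v‖) ^ n / n.factorial)))
    (fun n => hA.aestronglyMeasurable.restrict.mul
      (continuous_dysonSeq hA t n).aestronglyMeasurable) ?_ ?_ ?_ ?_
  · refine fun n => ae_of_all _ fun u hu => ?_
    rw [Set.uIoc_of_le hts] at hu
    exact (norm_mul_le _ _).trans (mul_le_mul_of_nonneg_left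
      (norm_dysonSeq_le_of_le hA ⟨hu.1.le, hu.2⟩ n) (norm_nonneg _))
  · exact ae_of_all _ fun u _ => (summable_dysonSeq_bound _ _).mul_left _
  · simp_rw [tsum_mul_left]
    exact hA.norm.intervalIntegrable.mul_const _
  · refine ae_of_all _ fun u hu => ?_
    rw [Set.uIoc_of_le hts] at hu
    exact (summable_dysonSeq hA hu.1.le).hasSum.mul_left _

theorem dysonSeq_eq_smul_pow [CompleteSpace 𝔸] {A : ℝ → 𝔸} (hA : Integrable A) {t T : ℝ}
    (hcomm : ∀ u ∈ Set.Ioc t T, ∀ v ∈ Set.Ioc t T, Commute (A u) (A v)) (n : ℕ) :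
    ∀ s ∈ Set.Icc t T, dysonSeq A t n s = ((n.factorial : ℝ)⁻¹) • (∫ u in t..s, A u) ^ n := by
  induction n with
  | zero => intro s _; simp [dysonSeq]
  | succ n ih =>
    intro s hs
    rw [← integral_mul_primitive_pow hA hcomm n s hs, dysonSeq, smul_smul,
      ← intervalIntegral.integral_smul]
    refine intervalIntegral.integral_congr fun u hu => ?_
    rw [Set.uIcc_of_le hs.1] at hu
    rw [ih u ⟨hu.1, hu.2.trans hs.2⟩, mul_smul_comm, Nat.factorial_succ]
    push_cast
    have : (n : ℝ) + 1 ≠ 0 := by positivity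
    congr 1
    field_simp

/-- The scalar Dyson series: `exp (∫ g)` is an antiderivative of `g exp (∫ g)` although `g` is only
integrable. -/
theorem exp_integral_eq {g : ℝ → ℝ} (hg : Integrable g) {t s : ℝ} (hts : t ≤ s) :
    Real.exp (∫ u in t..s, g u) = 1 + ∫ u in t..s, g u * Real.exp (∫ v in t..u, g v) := by
  have h : ∀ u, t ≤ u → ∑' n, dysonSeq g t n u = Real.exp (∫ v in t..u, g v) := fun u hu => by
    rw [Real.exp_eq_exp_ℝ, NormedSpace.exp_eq_tsum ℝ]
    exact tsum_congr fun n =>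
      dysonSeq_eq_smul_pow hg (fun _ _ _ _ => Commute.all _ _) n u ⟨hu, le_rfl⟩
  rw [← h s hts, tsum_dysonSeq_eq hg hts]
  congr 1
  refine intervalIntegral.integral_congr fun u hu => ?_
  rw [Set.uIcc_of_le hts] at hu
  simp only [h u hu.1]

end DysonSeries

/-! ### The time-ordered exponential of a matrix function -/

section MatrixDysonSeries

variable {N : ℕ}

/-- Square matrices as the Banach algebra of operators on `Fin N → ℝ`. Passing to operators gives
a submultiplicative norm while leaving matrices with their entrywise topology. -/
noncomputable def matrixToOperator (N : ℕ) :
    Matrix (Fin N) (Fin N) ℝ ≃ₐ[ℝ] ((Fin N → ℝ) →L[ℝ] (Fin N → ℝ)) :=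
  Matrix.toLinAlgEquiv'.trans (Module.End.toContinuousLinearMap (Fin N → ℝ))

theorem matrixToOperator_apply (M : Matrix (Fin N) (Fin N) ℝ) (v : Fin N → ℝ) :
    matrixToOperator N M v = M *ᵥ v :=
  rfl

theorem matrixToOperator_symm_apply (L : (Fin N → ℝ) →L[ℝ] (Fin N → ℝ)) (i j : Fin N) :
    (matrixToOperator N).symm L i j = L (Pi.single j 1) i := by
  obtain ⟨M, rfl⟩ := (matrixToOperator N).surjective L
  simp [matrixToOperator_apply]

theorem continuous_matrixToOperator_symm : Continuous (matrixToOperator N).symm :=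
  (matrixToOperator N).symm.toLinearMap.continuous_of_finiteDimensional

theorem matrixToOperator_symm_intervalIntegral {f : ℝ → (Fin N → ℝ) →L[ℝ] (Fin N → ℝ)} {t s : ℝ}
    (hf : IntervalIntegrable f volume t s) (i j : Fin N) :
    (matrixToOperator N).symm (∫ u in t..s, f u) i j =
      ∫ u in t..s, (matrixToOperator N).symm (f u) i j := by
  simp_rw [matrixToOperator_symm_apply]
  exact (((ContinuousLinearMap.proj (R := ℝ) (φ := fun _ : Fin N => ℝ) i).comp
    (ContinuousLinearMap.apply ℝ _ (Pi.single j 1))).intervalIntegral_comp_comm hf).symm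

theorem Matrix.integrable_linearMap_comp {E : Type*} [NormedAddCommGroup E] [NormedSpace ℝ E]
    (L : Matrix (Fin N) (Fin N) ℝ →ₗ[ℝ] E) {f : ℝ → Matrix (Fin N) (Fin N) ℝ} {ν : Measure ℝ}
    (hf : ∀ i j, Integrable (fun s => f s i j) ν) : Integrable (fun s => L (f s)) ν := by
  have h : (fun s => L (f s)) = fun s => ∑ i, ∑ j, f s i j • L (Matrix.single i j (1 : ℝ)) := by
    ext s : 1
    conv_lhs => rw [Matrix.matrix_eq_sum_single (f s)]
    simp_rw [map_sum, ← map_smul, Matrix.smul_single, smul_eq_mul, mul_one]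
  rw [h]
  exact integrable_finsetSum _ fun i _ => integrable_finsetSum _ fun j _ =>
    (hf i j).smul_const _

/-- The coefficient `A` as an operator-valued function, cut off outside `(t, T]` so as to be
integrable on the whole line. -/
noncomputable def operatorCoeff (A : ℝ → Matrix (Fin N) (Fin N) ℝ) (t T : ℝ) :
    ℝ → (Fin N → ℝ) →L[ℝ] (Fin N → ℝ) :=
  (Set.Ioc t T).indicator fun s => matrixToOperator N (A s)

variable {A : ℝ → Matrix (Fin N) (Fin N) ℝ} {t T : ℝ}

theorem integrable_operatorCoeff (htT : t ≤ T)
    (hA : ∀ i j, IntervalIntegrable (fun s => A s i j) volume t T) :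
    Integrable (operatorCoeff A t T) :=
  IntegrableOn.integrable_indicator (f := fun s => matrixToOperator N (A s))
    (Matrix.integrable_linearMap_comp (matrixToOperator N).toLinearMap
      fun i j => (intervalIntegrable_iff_integrableOn_Ioc_of_le htT).1 (hA i j)) measurableSet_Ioc

theorem operatorCoeff_of_mem {u s : ℝ} (hs : s ∈ Set.Icc t T) (hu : u ∈ Set.Ioc t s) :
    operatorCoeff A t T u = matrixToOperator N (A u) :=
  Set.indicator_of_mem (show u ∈ Set.Ioc t T from ⟨hu.1, hu.2.trans hs.2⟩) _

theorem dysonTerm_eq_dysonSeq (hA : Integrable (operatorCoeff A t T)) (n : ℕ) :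
    ∀ s ∈ Set.Icc t T,
      dysonTerm A t n s = (matrixToOperator N).symm (dysonSeq (operatorCoeff A t T) t n s) := by
  induction n with
  | zero => intro s _; exact (map_one _).symm
  | succ n ih =>
    intro s hs
    ext i j
    rw [dysonTerm, dysonSeq, matrixToOperator_symm_intervalIntegral
      (hA.intervalIntegrable.mul_continuousOn (continuous_dysonSeq hA t n).continuousOn),
      Matrix.of_apply]
    refine intervalIntegral.integral_congr_ae (ae_of_all _ fun u hu => ?_)
    rw [Set.uIoc_of_le hs.1] at hu
    rw [ih u ⟨hu.1.le, hu.2.trans hs.2⟩, operatorCoeff_of_mem hs hu, map_mul,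
      AlgEquiv.symm_apply_apply]

theorem hasSum_dysonTerm (hA : Integrable (operatorCoeff A t T)) {s : ℝ} (hs : s ∈ Set.Icc t T) :
    HasSum (fun n => dysonTerm A t n s)
      ((matrixToOperator N).symm (∑' n, dysonSeq (operatorCoeff A t T) t n s)) := by
  simp_rw [dysonTerm_eq_dysonSeq hA _ s hs]
  exact (summable_dysonSeq hA hs.1).hasSum.map _ continuous_matrixToOperator_symm

theorem summable_dysonTerm (htT : t ≤ T)
    (hA : ∀ i j, IntervalIntegrable (fun s => A s i j) volume t T) {s : ℝ} (hs : s ∈ Set.Icc t T) :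
    Summable fun n => dysonTerm A t n s :=
  (hasSum_dysonTerm (integrable_operatorCoeff htT hA) hs).summable

theorem isFundamentalSolution_timeOrderedExp (htT : t ≤ T)
    (hA : ∀ i j, IntervalIntegrable (fun s => A s i j) volume t T) :
    IsFundamentalSolution A t T (timeOrderedExp A t) := by
  have hA' := integrable_operatorCoeff htT hA
  have heq : ∀ s ∈ Set.Icc t T, timeOrderedExp A t s = _ :=
    fun s hs => (hasSum_dysonTerm hA' hs).tsum_eq
  refine ⟨(continuous_matrixToOperator_symm.comp_continuousOn
    (continuousOn_tsum_dysonSeq hA' t T)).congr heq, fun s hs i j => ?_⟩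
  have hint : IntervalIntegrable (fun u => operatorCoeff A t T u *
      ∑' n, dysonSeq (operatorCoeff A t T) t n u) volume t s := by
    refine hA'.intervalIntegrable.mul_continuousOn ?_
    rw [Set.uIcc_of_le hs.1]
    exact continuousOn_tsum_dysonSeq hA' t s
  rw [heq s hs, tsum_dysonSeq_eq hA' hs.1, map_add, map_one, Matrix.add_apply,
    matrixToOperator_symm_intervalIntegral hint]
  congr 1
  refine intervalIntegral.integral_congr_ae (ae_of_all _ fun u hu => ?_)
  rw [Set.uIoc_of_le hs.1] at hu
  rw [heq u ⟨hu.1.le, hu.2.trans hs.2⟩, operatorCoeff_of_mem hs hu, map_mul,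
    AlgEquiv.symm_apply_apply]

theorem intervalIntegrable_mul_entry (htT : t ≤ T)
    (hA : ∀ i j, IntervalIntegrable (fun s => A s i j) volume t T)
    {Φ : ℝ → Matrix (Fin N) (Fin N) ℝ} (hΦ : ContinuousOn Φ (Set.Icc t T)) {s : ℝ}
    (hs : s ∈ Set.Icc t T) (i j : Fin N) :
    IntervalIntegrable (fun u => (A u * Φ u) i j) volume t s := by
  have hsub : Set.uIcc t s ⊆ Set.Icc t T := by
    rw [Set.uIcc_of_le hs.1]; exact Set.Icc_subset_Icc_right hs.2
  have h := IntervalIntegrable.sum (μ := volume) (a := t) (b := s) Finset.univ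
    (f := fun k u => A u i k * Φ u k j) fun k _ =>
    ((hA i k).mono_set (by rwa [Set.uIcc_of_le htT])).mul_continuousOn
      (((continuous_apply_apply k j).comp_continuousOn hΦ).mono hsub)
  refine h.congr fun u _ => ?_
  simp [Matrix.mul_apply]

/-- Solutions of the linear equation that are merely bounded are determined by their initial
value. The vector case is the one needed for expectations of functionals of the chain. -/
theorem eq_timeOrderedExp_mulVec (htT : t ≤ T)
    (hA : ∀ i j, IntervalIntegrable (fun s => A s i j) volume t T)
    {z : ℝ → Fin N → ℝ} {C : ℝ} (hzC : ∀ s ∈ Set.Icc t T, ‖z s‖ ≤ C)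
    (hint : ∀ i j, IntervalIntegrable (fun u => A u i j * z u j) volume t T)
    (hz : ∀ s ∈ Set.Icc t T, ∀ i, z s i = z t i + ∫ u in t..s, (A u *ᵥ z u) i)
    {s : ℝ} (hs : s ∈ Set.Icc t T) : z s = timeOrderedExp A t s *ᵥ z t := by
  have hA' := integrable_operatorCoeff htT hA
  have hΦ := isFundamentalSolution_timeOrderedExp htT hA
  set Φ := timeOrderedExp A t
  have hΦv : ContinuousOn (fun s => Φ s *ᵥ z t) (Set.Icc t T) :=
    (continuous_id.matrix_mulVec continuous_const).comp_continuousOn hΦ.continuousOn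
  obtain ⟨C', hC'⟩ := isCompact_Icc.exists_bound_of_continuousOn hΦv
  have hAz : ∀ s ∈ Set.Icc t T, ∀ i, IntervalIntegrable (fun u => (A u *ᵥ z u) i) volume t s := by
    intro s hs i
    refine IntervalIntegrable.mono_set (?_ : IntervalIntegrable _ volume t T) ?_
    · refine (IntervalIntegrable.sum Finset.univ (f := fun k u => A u i k * z u k)
        fun k _ => hint i k).congr fun u _ => ?_
      simp [Matrix.mulVec, dotProduct]
    · rw [Set.uIcc_of_le hs.1, Set.uIcc_of_le htT]; exact Set.Icc_subset_Icc_right hs.2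
  have hAΦk := fun (s : ℝ) (hs : s ∈ Set.Icc t T) i k =>
    (intervalIntegrable_mul_entry htT hA hΦ.continuousOn hs i k).mul_const (z t k)
  have hAΦ : ∀ s ∈ Set.Icc t T, ∀ i,
      IntervalIntegrable (fun u => (A u *ᵥ (Φ u *ᵥ z t)) i) volume t s := by
    intro s hs i
    refine (IntervalIntegrable.sum Finset.univ (f := fun k u => (A u * Φ u) i k * z t k)
      fun k _ => hAΦk s hs i k).congr fun u _ => ?_
    rw [Finset.sum_apply, Matrix.mulVec_mulVec]
    rfl
  rw [← sub_eq_zero]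
  refine eq_zero_of_eq_integral hA'.norm (C := C + C') (fun s => z s - Φ s *ᵥ z t)
    (fun u => operatorCoeff A t T u (z u - Φ u *ᵥ z t))
    (fun u hu => (norm_sub_le _ _).trans (add_le_add (hzC u hu) (hC' u hu)))
    (fun u _ => ContinuousLinearMap.le_opNorm _ _) (fun _ => norm_nonneg _) (fun s hs => ?_) hs
  have hcongr : ∫ u in t..s, operatorCoeff A t T u (z u - Φ u *ᵥ z t) =
      ∫ u in t..s, (A u *ᵥ z u - A u *ᵥ (Φ u *ᵥ z t)) := by
    refine intervalIntegral.integral_congr_ae (ae_of_all _ fun u hu => ?_)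
    rw [Set.uIoc_of_le hs.1] at hu
    rw [operatorCoeff_of_mem hs hu, matrixToOperator_apply, Matrix.mulVec_sub]
  have hvec : IntervalIntegrable (fun u => A u *ᵥ z u - A u *ᵥ (Φ u *ᵥ z t)) volume t s := by
    rw [intervalIntegrable_iff]
    exact Integrable.of_eval fun i => intervalIntegrable_iff.1 ((hAz s hs i).sub (hAΦ s hs i))
  rw [hcongr]
  ext i
  have happ : (∫ u in t..s, (A u *ᵥ z u - A u *ᵥ (Φ u *ᵥ z t))) i =
      ∫ u in t..s, (A u *ᵥ z u - A u *ᵥ (Φ u *ᵥ z t)) i :=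
    ((ContinuousLinearMap.proj (R := ℝ) (φ := fun _ : Fin N => ℝ) i).intervalIntegral_comp_comm
      hvec).symm
  rw [happ]
  simp_rw [Pi.sub_apply]
  rw [intervalIntegral.integral_sub (hAz s hs i) (hAΦ s hs i), hz s hs i]
  have hΦi : (Φ s *ᵥ z t) i = z t i + ∫ u in t..s, (A u *ᵥ (Φ u *ᵥ z t)) i := by
    simp_rw [Matrix.mulVec_mulVec]
    simp_rw [Matrix.mulVec, dotProduct, hΦ.integral_eq s hs, add_mul, Finset.sum_add_distrib,
      Matrix.one_apply, ite_mul, one_mul, zero_mul, Finset.sum_ite_eq, Finset.mem_univ, if_true]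
    rw [intervalIntegral.integral_finsetSum fun k _ => hAΦk s hs i k]
    simp_rw [intervalIntegral.integral_mul_const]
  rw [hΦi]
  ring

theorem IsFundamentalSolution.eqOn_timeOrderedExp (htT : t ≤ T)
    (hA : ∀ i j, IntervalIntegrable (fun s => A s i j) volume t T)
    {Ψ : ℝ → Matrix (Fin N) (Fin N) ℝ} (hΨ : IsFundamentalSolution A t T Ψ) :
    Set.EqOn Ψ (timeOrderedExp A t) (Set.Icc t T) := by
  intro s hs
  ext i j
  have htt : t ∈ Set.Icc t T := ⟨le_rfl, htT⟩
  have hcol : ContinuousOn (fun u => (Ψ u).col j) (Set.Icc t T) :=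
    continuousOn_pi.2 fun k => (continuous_apply_apply k j).comp_continuousOn hΨ.continuousOn
  obtain ⟨C, hC⟩ := isCompact_Icc.exists_bound_of_continuousOn hcol
  have hΨt : ∀ k, Ψ t k j = (1 : Matrix (Fin N) (Fin N) ℝ) k j := fun k => by
    simpa using hΨ.integral_eq t htt k j
  have h := eq_timeOrderedExp_mulVec htT hA (z := fun u => (Ψ u).col j) hC (fun i k => ?_)
    (fun s hs i => ?_) hs
  · have h' := congr_fun h i
    have hone : (Ψ t).col j = Pi.single j 1 := by
      ext k; simp [Matrix.col_apply, hΨt, Matrix.one_apply, Pi.single_apply]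
    rw [hone, Matrix.mulVec_single_one] at h'
    exact h'
  · refine (hA i k).mul_continuousOn ?_
    rw [Set.uIcc_of_le htT]
    exact (continuous_apply k).comp_continuousOn hcol
  · change Ψ s i j = Ψ t i j + ∫ u in t..s, (A u * Ψ u) i j
    rw [hΨ.integral_eq s hs, hΨt]

theorem hasDerivWithinAt_timeOrderedExp (htT : t ≤ T)
    (hA : ∀ i j, IntervalIntegrable (fun s => A s i j) volume t T) {s : ℝ} (hs : s ∈ Set.Icc t T)
    (hAs : ContinuousWithinAt A (Set.Icc t T) s) (i j : Fin N) :
    HasDerivWithinAt (fun u => timeOrderedExp A t u i j) ((A s * timeOrderedExp A t s) i j)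
      (Set.Icc t T) s := by
  have hΦ := isFundamentalSolution_timeOrderedExp htT hA
  set Φ := timeOrderedExp A t
  have hint := fun u hu =>
    intervalIntegrable_mul_entry htT hA hΦ.continuousOn (s := u) hu i j
  have hmeas : StronglyMeasurableAtFilter (fun u => (A u * Φ u) i j)
      (nhdsWithin s (Set.Icc t T)) :=
    ⟨Set.Icc t T, self_mem_nhdsWithin, ((intervalIntegrable_iff_integrableOn_Icc_of_le htT).1
      (hint T ⟨htT, le_rfl⟩)).aestronglyMeasurable⟩
  have hcont : ContinuousWithinAt (fun u => (A u * Φ u) i j) (Set.Icc t T) s :=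
    (continuous_apply_apply i j).continuousAt.comp_continuousWithinAt
      (hAs.mul (hΦ.continuousOn s hs))
  have : Fact (s ∈ Set.Icc t T) := ⟨hs⟩
  have hder := intervalIntegral.integral_hasDerivWithinAt_right (s := Set.Icc t T) (hint s hs)
    hmeas hcont
  exact (hder.const_add ((1 : Matrix (Fin N) (Fin N) ℝ) i j)).congr
    (fun u hu => hΦ.integral_eq u hu i j) (hΦ.integral_eq s hs i j)

theorem timeOrderedExp_eq_exp (htT : t ≤ T)
    (hA : ∀ i j, IntervalIntegrable (fun s => A s i j) volume t T)
    (hcomm : ∀ s ∈ Set.Icc t T, ∀ u ∈ Set.Icc t T, Commute (A s) (A u)) :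
    timeOrderedExp A t T = NormedSpace.exp (Matrix.of fun i j => ∫ s in t..T, A s i j) := by
  have hA' := integrable_operatorCoeff htT hA
  have hTT : T ∈ Set.Icc t T := ⟨htT, le_rfl⟩
  have hint : (matrixToOperator N).symm (∫ u in t..T, operatorCoeff A t T u) =
      Matrix.of fun i j => ∫ s in t..T, A s i j := by
    ext i j
    rw [matrixToOperator_symm_intervalIntegral hA'.intervalIntegrable, Matrix.of_apply]
    refine intervalIntegral.integral_congr_ae (ae_of_all _ fun u hu => ?_)
    rw [Set.uIoc_of_le htT] at hu
    rw [operatorCoeff_of_mem hTT hu, AlgEquiv.symm_apply_apply]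
  have hcomm' : ∀ u ∈ Set.Ioc t T, ∀ v ∈ Set.Ioc t T,
      Commute (operatorCoeff A t T u) (operatorCoeff A t T v) := fun u hu v hv => by
    rw [operatorCoeff_of_mem hTT hu, operatorCoeff_of_mem hTT hv]
    exact (hcomm u ⟨hu.1.le, hu.2⟩ v ⟨hv.1.le, hv.2⟩).map (matrixToOperator N)
  rw [NormedSpace.exp_eq_tsum ℝ]
  refine tsum_congr fun n => ?_
  rw [dysonTerm_eq_dysonSeq hA' n T hTT, dysonSeq_eq_smul_pow hA' hcomm' n T hTT, map_smul,
    map_pow, hint]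

end MatrixDysonSeries

/-! ### Measurability of additive functionals of right-continuous processes -/

section PathIntegrals

open Filter Topology

variable {Ω : Type*} {N : ℕ}

theorem tendsto_floor_add_one_div_nhdsWithin_Ici (r : ℝ) :
    Tendsto (fun n : ℕ => ((⌊((n : ℝ) + 1) * r⌋ : ℝ) + 1) / ((n : ℝ) + 1)) atTop
      (𝓝[Set.Ici r] r) := by
  have hn : ∀ n : ℕ, (0 : ℝ) < (n : ℝ) + 1 := fun n => by positivity
  have hge : ∀ n : ℕ, r ≤ ((⌊((n : ℝ) + 1) * r⌋ : ℝ) + 1) / ((n : ℝ) + 1) := fun n => by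
    rw [le_div_iff₀ (hn n), mul_comm]
    exact (Int.lt_floor_add_one _).le
  have hle : ∀ n : ℕ, ((⌊((n : ℝ) + 1) * r⌋ : ℝ) + 1) / ((n : ℝ) + 1) ≤ r + 1 / ((n : ℝ) + 1) :=
    fun n => by
      have h1 := Int.floor_le (((n : ℝ) + 1) * r)
      rw [div_le_iff₀ (hn n), add_mul r, one_div_mul_cancel (hn n).ne']
      linarith
  refine tendsto_nhdsWithin_iff.2 ⟨?_, Eventually.of_forall hge⟩
  refine tendsto_of_tendsto_of_tendsto_of_le_of_le tendsto_const_nhds ?_ hge hle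
  simpa using (tendsto_one_div_add_atTop_nhds_zero_nat (𝕜 := ℝ)).const_add r

/-- A right-continuous process is jointly measurable, being the limit of the processes sampled at
the first point of the grid `ℤ / (n + 1)` strictly after the current time. -/
theorem measurable_uncurry_of_continuousWithinAt_Ici {m : MeasurableSpace Ω} {h : ℝ → Ω → ℝ}
    (hm : ∀ r, Measurable (h r))
    (hc : ∀ ω r, ContinuousWithinAt (fun u => h u ω) (Set.Ici r) r) :
    Measurable (Function.uncurry h) := by
  have hlim : ∀ p : ℝ × Ω,
      Tendsto (fun n : ℕ => h (((⌊((n : ℝ) + 1) * p.1⌋ : ℝ) + 1) / ((n : ℝ) + 1)) p.2) atTop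
        (𝓝 (Function.uncurry h p)) := fun p =>
    Tendsto.comp (hc p.2 p.1) (tendsto_floor_add_one_div_nhdsWithin_Ici p.1)
  refine measurable_of_tendsto_metrizable (fun n => ?_) (tendsto_pi_nhds.2 hlim)
  have hk : Measurable fun p : ℤ × Ω => h (((p.1 : ℝ) + 1) / ((n : ℝ) + 1)) p.2 :=
    measurable_from_prod_countable_right fun k => hm (((k : ℝ) + 1) / ((n : ℝ) + 1))
  have hfloor : Measurable fun p : ℝ × Ω => (⌊((n : ℝ) + 1) * p.1⌋, p.2) :=
    (Int.measurable_floor.comp (measurable_fst.const_mul _)).prodMk measurable_snd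
  exact hk.comp hfloor

/-- The additive functional `∫ₜˢ ⟨a(r), y(r)⟩ dr` of a path of the process `y`. -/
noncomputable def pathIntegral (a : ℝ → Fin N → ℝ) (y : ℝ → Ω → Fin N → ℝ) (t s : ℝ) (ω : Ω) : ℝ :=
  ∫ r in t..s, a r ⬝ᵥ y r ω

variable {a : ℝ → Fin N → ℝ} {y : ℝ → Ω → Fin N → ℝ}

theorem abs_dotProduct_le_sum {b v : Fin N → ℝ} (hv : ∀ k, |v k| ≤ 1) : |b ⬝ᵥ v| ≤ ∑ k, |b k| :=
  (Finset.abs_sum_le_sum_abs _ _).trans (Finset.sum_le_sum fun k _ => by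
    rw [abs_mul]; exact mul_le_of_le_one_right (abs_nonneg _) (hv k))

theorem integrable_sum_abs (ha : ∀ k, Integrable fun r => a r k) :
    Integrable fun r => ∑ k, |a r k| :=
  integrable_finsetSum _ fun k _ => (ha k).abs

variable {m : MeasurableSpace Ω}

theorem integrable_dotProduct_path (ha : ∀ k, Integrable fun r => a r k)
    (hym : ∀ k, Measurable fun p : ℝ × Ω => y p.1 p.2 k) (hy1 : ∀ r ω k, |y r ω k| ≤ 1) (ω : Ω) :
    Integrable fun r => a r ⬝ᵥ y r ω :=
  integrable_finsetSum _ fun k _ => (ha k).mul_bdd (c := 1)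
    ((hym k).comp (measurable_id.prodMk measurable_const)).aestronglyMeasurable
    (ae_of_all _ fun r => hy1 r ω k)

theorem continuous_pathIntegral (ha : ∀ k, Integrable fun r => a r k)
    (hym : ∀ k, Measurable fun p : ℝ × Ω => y p.1 p.2 k) (hy1 : ∀ r ω k, |y r ω k| ≤ 1) (t : ℝ)
    (ω : Ω) : Continuous fun s => pathIntegral a y t s ω :=
  continuous_primitive_of_integrable (integrable_dotProduct_path ha hym hy1 ω) t

theorem stronglyMeasurable_pathIntegral (ha : ∀ k, Integrable fun r => a r k)
    (hym : ∀ k, Measurable fun p : ℝ × Ω => y p.1 p.2 k) (t s : ℝ) :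
    StronglyMeasurable (pathIntegral a y t s) := by
  -- a Borel version of `a` makes the integrand jointly measurable
  set b : ℝ → Fin N → ℝ := fun r k => (ha k).aestronglyMeasurable.mk _ r
  have hb : ∀ k, Measurable fun r => b r k :=
    fun k => (ha k).aestronglyMeasurable.stronglyMeasurable_mk.measurable
  have hab : ∀ᵐ r, a r = b r := by
    have := ae_all_iff.2 fun k => (ha k).aestronglyMeasurable.ae_eq_mk
    filter_upwards [this] with r hr
    exact funext hr
  have hjoint : Measurable fun p : ℝ × Ω => b p.1 ⬝ᵥ y p.1 p.2 :=
    Finset.measurable_sum _ fun k _ => ((hb k).comp measurable_fst).mul (hym k)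
  have heq : pathIntegral a y t s = fun ω => ∫ r in t..s, b r ⬝ᵥ y r ω := by
    ext ω
    refine intervalIntegral.integral_congr_ae ?_
    filter_upwards [hab] with r hr _
    rw [hr]
  rw [heq]
  simp only [intervalIntegral]
  exact (hjoint.stronglyMeasurable.comp_measurable measurable_swap).integral_prod_right'.sub
    (hjoint.stronglyMeasurable.comp_measurable measurable_swap).integral_prod_right'

theorem measurable_uncurry_pathIntegral (ha : ∀ k, Integrable fun r => a r k)
    (hym : ∀ k, Measurable fun p : ℝ × Ω => y p.1 p.2 k) (hy1 : ∀ r ω k, |y r ω k| ≤ 1) (t : ℝ) :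
    Measurable fun p : ℝ × Ω => pathIntegral a y t p.1 p.2 :=
  measurable_uncurry_of_continuous_of_measurable
    (u := fun s ω => pathIntegral a y t s ω)
    (fun ω => continuous_pathIntegral ha hym hy1 t ω)
    fun s => (stronglyMeasurable_pathIntegral ha hym t s).measurable

theorem abs_pathIntegral_le (ha : ∀ k, Integrable fun r => a r k) (hy1 : ∀ r ω k, |y r ω k| ≤ 1)
    {t u s T : ℝ} (htu : t ≤ u) (hus : u ≤ s) (hsT : s ≤ T) (ω : Ω) :
    |pathIntegral a y u s ω| ≤ ∫ r in t..T, ∑ k, |a r k| := by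
  have h1 : |pathIntegral a y u s ω| ≤ ∫ r in u..s, ∑ k, |a r k| :=
    intervalIntegral.norm_integral_le_of_norm_le (f := fun r => a r ⬝ᵥ y r ω) hus
      (ae_of_all _ fun r _ => abs_dotProduct_le_sum (hy1 r ω))
      (integrable_sum_abs ha).intervalIntegrable
  exact h1.trans (intervalIntegral.integral_mono_interval htu hus hsT
    (ae_of_all _ fun r => Finset.sum_nonneg fun _ _ => abs_nonneg _)
    (integrable_sum_abs ha).intervalIntegrable)

theorem pathIntegral_add_adjacent (ha : ∀ k, Integrable fun r => a r k)
    (hym : ∀ k, Measurable fun p : ℝ × Ω => y p.1 p.2 k) (hy1 : ∀ r ω k, |y r ω k| ≤ 1)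
    (t u s : ℝ) (ω : Ω) :
    pathIntegral a y t u ω + pathIntegral a y u s ω = pathIntegral a y t s ω :=
  intervalIntegral.integral_add_adjacent_intervals
    (integrable_dotProduct_path ha hym hy1 ω).intervalIntegrable
    (integrable_dotProduct_path ha hym hy1 ω).intervalIntegrable

theorem measurable_uncurry_path {mΩ : MeasurableSpace Ω} {𝒢 : Filtration ℝ mΩ}
    (hadapt : ∀ r k, Measurable[𝒢 r] fun ω => y r ω k)
    (hright : ∀ ω r, ContinuousWithinAt (fun u => y u ω) (Set.Ici r) r) (k : Fin N) :
    Measurable fun p : ℝ × Ω => y p.1 p.2 k :=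
  measurable_uncurry_of_continuousWithinAt_Ici (h := fun r ω => y r ω k)
    (fun r => (hadapt r k).mono (𝒢.le r) le_rfl)
    fun ω r => (continuous_apply k).continuousAt.comp_continuousWithinAt (hright ω r)

/-- Additive functionals of an adapted right-continuous process are adapted: freezing the process
at the terminal time `u` makes it jointly measurable with respect to `𝒢 u`. -/
theorem stronglyMeasurable_filtration_pathIntegral {mΩ : MeasurableSpace Ω} {𝒢 : Filtration ℝ mΩ}
    (ha : ∀ k, Integrable fun r => a r k) (hadapt : ∀ r k, Measurable[𝒢 r] fun ω => y r ω k)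
    (hright : ∀ ω r, ContinuousWithinAt (fun u => y u ω) (Set.Ici r) r) {t u : ℝ} (htu : t ≤ u) :
    StronglyMeasurable[𝒢 u] (pathIntegral a y t u) := by
  have hfreeze : pathIntegral a y t u = pathIntegral a (fun r => y (min r u)) t u := by
    ext ω
    refine intervalIntegral.integral_congr fun r hr => ?_
    rw [Set.uIcc_of_le htu] at hr
    simp only [min_eq_left hr.2]
  rw [hfreeze]
  refine stronglyMeasurable_pathIntegral (m := 𝒢 u) ha (fun k => ?_) t u
  refine measurable_uncurry_of_continuousWithinAt_Ici (m := 𝒢 u)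
    (h := fun r ω => y (min r u) ω k)
    (fun r => (hadapt _ k).mono (𝒢.mono (min_le_right _ _)) le_rfl)
    fun ω r => ?_
  refine (continuous_apply k).continuousAt.comp_continuousWithinAt ?_
  exact (hright ω (min r u)).comp (f := fun r => min r u)
    (continuous_id.min continuous_const).continuousWithinAt
    fun r' hr' => min_le_min_right u hr'

end PathIntegrals

/-! ### Exchanging time integrals and expectations -/

section Fubini

variable {Ω : Type*} {mΩ : MeasurableSpace Ω} {ν : Measure Ω} [IsFiniteMeasure ν]
  {a : ℝ → ℝ} {b : ℝ → Ω → ℝ} {t s C : ℝ}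

theorem integrable_prod_mul_of_bound (ha : Integrable a)
    (hb : Measurable fun p : ℝ × Ω => b p.1 p.2) (hC : ∀ u ∈ Set.Ioc t s, ∀ ω, |b u ω| ≤ C) :
    Integrable (fun p : ℝ × Ω => a p.1 * b p.1 p.2) ((volume.restrict (Set.Ioc t s)).prod ν) := by
  refine (ha.restrict.comp_fst ν).mul_bdd (c := C) hb.aestronglyMeasurable ?_
  have h : ∀ᵐ p : ℝ × Ω ∂((volume.restrict (Set.Ioc t s)).prod ν), p.1 ∈ Set.Ioc t s :=
    Measure.quasiMeasurePreserving_fst.ae (ae_restrict_mem measurableSet_Ioc)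
  filter_upwards [h] with p hp
  exact hC p.1 hp p.2

theorem intervalIntegrable_mul_expectation (ha : Integrable a)
    (hb : Measurable fun p : ℝ × Ω => b p.1 p.2) (hC : ∀ u ∈ Set.Ioc t s, ∀ ω, |b u ω| ≤ C)
    (hts : t ≤ s) : IntervalIntegrable (fun u => a u * ∫ ω, b u ω ∂ν) volume t s := by
  rw [intervalIntegrable_iff_integrableOn_Ioc_of_le hts]
  have h := (integrable_prod_mul_of_bound (ν := ν) ha hb hC).integral_prod_left
  simp only [integral_const_mul] at h
  exact h

theorem integrable_intervalIntegral_mul (ha : Integrable a)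
    (hb : Measurable fun p : ℝ × Ω => b p.1 p.2) (hC : ∀ u ∈ Set.Ioc t s, ∀ ω, |b u ω| ≤ C)
    (hts : t ≤ s) : Integrable (fun ω => ∫ u in t..s, a u * b u ω) ν := by
  simp_rw [intervalIntegral.integral_of_le hts]
  exact (integrable_prod_mul_of_bound (ν := ν) ha hb hC).integral_prod_right

theorem integral_intervalIntegral_mul (ha : Integrable a)
    (hb : Measurable fun p : ℝ × Ω => b p.1 p.2) (hC : ∀ u ∈ Set.Ioc t s, ∀ ω, |b u ω| ≤ C)
    (hts : t ≤ s) :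
    ∫ ω, (∫ u in t..s, a u * b u ω) ∂ν = ∫ u in t..s, a u * ∫ ω, b u ω ∂ν := by
  simp_rw [intervalIntegral.integral_of_le hts, ← integral_const_mul]
  exact (integral_integral_swap (f := fun u ω => a u * b u ω) 
    (integrable_prod_mul_of_bound (ν := ν) ha hb hC)).symm

end Fubini

/-- If `𝔼[D | m] = 0`, then `D` integrates to zero against `m`-measurable weights. -/
theorem integral_mul_eq_zero_of_forall_setIntegral_eq_zero {Ω : Type*} {m mΩ : MeasurableSpace Ω}
    (hm : m ≤ mΩ) {ν : Measure Ω} [IsFiniteMeasure ν] {H D : Ω → ℝ} (hD : Integrable D ν)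
    (hH : StronglyMeasurable[m] H) (hHD : Integrable (H * D) ν)
    (h0 : ∀ B, MeasurableSet[m] B → ∫ ω in B, D ω ∂ν = 0) : ∫ ω, H ω * D ω ∂ν = 0 := by
  have h1 : (0 : Ω → ℝ) =ᵐ[ν] ν[D | m] :=
    ae_eq_condExp_of_forall_setIntegral_eq hm hD (fun _ _ _ => integrableOn_zero)
      (fun B hB _ => by simp [h0 B hB]) stronglyMeasurable_zero.aestronglyMeasurable
  have h2 := condExp_mul_of_stronglyMeasurable_left hH hHD hD
  calc ∫ ω, H ω * D ω ∂ν = ∫ ω, (ν[H * D | m]) ω ∂ν := (integral_condExp hm).symm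
    _ = 0 := by
      rw [integral_congr_ae (h2.trans (h1.mono fun ω h => ?_)) (g := 0)]
      · simp
      · simp [← h]

/-! ### The linear equation for the exponential functional -/

section FeynmanKac

/-- Integration by parts for `exp (∫ g)` times a function `Y` with `Y(s) = c`, arranged around the
increments over `[u, s]`. With `V` the primitive of `v`, the identity
`E(s) (c - V(s)) = (c - V(s)) (1 + ∫ g E)` is added to the product rule for `E V`. -/
theorem exp_integral_mul_const_eq {g v : ℝ → ℝ} (hg : Integrable g) (hv : Integrable v)
    {t s : ℝ} (hts : t ≤ s) (c : ℝ) :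
    Real.exp (∫ u in t..s, g u) * c = (c - ∫ u in t..s, v u) +
      (∫ u in t..s, g u * Real.exp (∫ r in t..u, g r) * (c - ∫ r in u..s, v r)) +
      ∫ u in t..s, Real.exp (∫ r in t..u, g r) * v u := by
  set E : ℝ → ℝ := fun u => Real.exp (∫ r in t..u, g r) with hE
  have hEc : Continuous E := Real.continuous_exp.comp (continuous_primitive_of_integrable hg t)
  have hVc := continuous_primitive_of_integrable hv t
  have hgE : IntervalIntegrable (fun u => g u * E u) volume t s :=
    hg.intervalIntegrable.mul_continuousOn hEc.continuousOn
  -- the product rule applies to globally integrable functions, hence the truncation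
  set f : ℝ → ℝ := (Set.Ioc t s).indicator fun u => g u * E u with hf
  have hfi : Integrable f := IntegrableOn.integrable_indicator (f := fun u => g u * E u)
    ((intervalIntegrable_iff_integrableOn_Ioc_of_le hts).1 hgE) measurableSet_Ioc
  have hfu : ∀ u ∈ Set.Icc t s, ∫ r in t..u, f r = E u - 1 := fun u hu => by
    rw [show E u = _ from exp_integral_eq hg hu.1, add_sub_cancel_left]
    refine intervalIntegral.integral_congr_ae (ae_of_all _ fun r hr => ?_)
    rw [Set.uIoc_of_le hu.1] at hr
    exact Set.indicator_of_mem (show r ∈ Set.Ioc t s from ⟨hr.1, hr.2.trans hu.2⟩) _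
  have hprod := integral_mul_integral_eq hfi hv hts
  have h1 : ∫ u in t..s, f u * ∫ r in t..u, v r =
      ∫ u in t..s, g u * E u * ∫ r in t..u, v r := by
    refine intervalIntegral.integral_congr_ae (ae_of_all _ fun u hu => ?_)
    rw [Set.uIoc_of_le hts] at hu
    rw [hf, Set.indicator_of_mem hu]
  have h2 : ∫ u in t..s, (∫ r in t..u, f r) * v u =
      (∫ u in t..s, E u * v u) - ∫ u in t..s, v u := by
    rw [← intervalIntegral.integral_sub
      (hv.intervalIntegrable.continuousOn_mul hEc.continuousOn) hv.intervalIntegrable]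
    refine intervalIntegral.integral_congr fun u hu => ?_
    rw [Set.uIcc_of_le hts] at hu
    simp only [hfu u hu]
    ring
  have h3 : ∫ u in t..s, g u * E u * (c - ∫ r in u..s, v r) =
      (E s - 1) * (c - ∫ u in t..s, v u) + ∫ u in t..s, g u * E u * ∫ r in t..u, v r := by
    have hEs : E s - 1 = ∫ u in t..s, g u * E u := by
      rw [show E s = _ from exp_integral_eq hg hts, add_sub_cancel_left]
    rw [hEs, ← intervalIntegral.integral_mul_const, ← intervalIntegral.integral_add
      (hgE.mul_const _) (hgE.mul_continuousOn hVc.continuousOn)]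
    refine intervalIntegral.integral_congr fun u _ => ?_
    rw [← intervalIntegral.integral_add_adjacent_intervals (hv.intervalIntegrable (a := t) (b := u))
      (hv.intervalIntegrable (a := u) (b := s))]
    ring
  rw [hfu s ⟨hts, le_rfl⟩, h1, h2] at hprod
  change E s * c = _
  rw [h3]
  linear_combination hprod

variable {Ω : Type*} {N : ℕ} {mΩ : MeasurableSpace Ω} {y : ℝ → Ω → Fin N → ℝ}

theorem abs_le_one_of_unitVector {v : Fin N → ℝ} (hv : ∃ i, v = Pi.single i 1) (k : Fin N) :
    |v k| ≤ 1 := by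
  obtain ⟨i, rfl⟩ := hv
  rw [Pi.single_apply]
  split_ifs <;> simp

theorem dotProduct_mul_of_unitVector {v : Fin N → ℝ} (hv : ∃ i, v = Pi.single i 1)
    (b : Fin N → ℝ) (k : Fin N) : (b ⬝ᵥ v) * v k = b k * v k := by
  obtain ⟨i, rfl⟩ := hv
  rw [dotProduct_single, mul_one, Pi.single_apply]
  split_ifs with h
  · rw [h]
  · simp

theorem exp_pathIntegral_le {j : ℝ → Fin N → ℝ} (hj : ∀ k, Integrable fun r => j r k)
    (hy1 : ∀ r ω k, |y r ω k| ≤ 1) {t T s : ℝ} (hs : s ∈ Set.Icc t T) (ω : Ω) :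
    |Real.exp (pathIntegral j y t s ω)| ≤ Real.exp (∫ r in t..T, ∑ k, |j r k|) := by
  rw [abs_of_pos (Real.exp_pos _)]
  exact Real.exp_le_exp.2 ((le_abs_self _).trans (abs_pathIntegral_le hj hy1 le_rfl hs.1 hs.2 ω))

theorem abs_exp_pathIntegral_mul_le {j : ℝ → Fin N → ℝ} (hj : ∀ k, Integrable fun r => j r k)
    (hy1 : ∀ r ω k, |y r ω k| ≤ 1) {t T s : ℝ} (hs : s ∈ Set.Icc t T) (ω : Ω) (k : Fin N) :
    |Real.exp (pathIntegral j y t s ω) * y s ω k| ≤ Real.exp (∫ r in t..T, ∑ k, |j r k|) := by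
  rw [abs_mul]
  exact (mul_le_of_le_one_right (abs_nonneg _) (hy1 s ω k)).trans (exp_pathIntegral_le hj hy1 hs ω)

theorem measurable_uncurry_exp_pathIntegral_mul {j : ℝ → Fin N → ℝ}
    (hj : ∀ k, Integrable fun r => j r k) (hym : ∀ k, Measurable fun p : ℝ × Ω => y p.1 p.2 k)
    (hy1 : ∀ r ω k, |y r ω k| ≤ 1) (t : ℝ) (k : Fin N) :
    Measurable fun p : ℝ × Ω => Real.exp (pathIntegral j y t p.1 p.2) * y p.1 p.2 k :=
  (Real.measurable_exp.comp (measurable_uncurry_pathIntegral hj hym hy1 t)).mul (hym k)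

theorem intervalIntegrable_mul_path {a : ℝ → ℝ} {b : ℝ → Ω → ℝ} {t s C : ℝ} (ha : Integrable a)
    (hb : Measurable fun p : ℝ × Ω => b p.1 p.2) (hC : ∀ u ∈ Set.Ioc t s, ∀ ω, |b u ω| ≤ C)
    (hts : t ≤ s) (ω : Ω) : IntervalIntegrable (fun u => a u * b u ω) volume t s := by
  rw [intervalIntegrable_iff_integrableOn_Ioc_of_le hts]
  refine Integrable.mul_bdd (c := C) ha.restrict
    (hb.comp (measurable_id.prodMk measurable_const)).aestronglyMeasurable ?_
  filter_upwards [ae_restrict_mem measurableSet_Ioc] with u hu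
  exact hC u hu ω

/-- The increment over `[u, s]` of the compensated `i`-th coordinate of the chain. -/
noncomputable def compensatedIncrement (q : Fin N → ℝ → Fin N → ℝ) (y : ℝ → Ω → Fin N → ℝ)
    (i : Fin N) (u s : ℝ) (ω : Ω) : ℝ :=
  y s ω i - y u ω i - pathIntegral (q i) y u s ω

variable {q : Fin N → ℝ → Fin N → ℝ} {j : ℝ → Fin N → ℝ} {t T s : ℝ}

theorem measurable_uncurry_compensatedIncrement (hq : ∀ i k, Integrable fun r => q i r k)
    (hym : ∀ k, Measurable fun p : ℝ × Ω => y p.1 p.2 k) (hy1 : ∀ r ω k, |y r ω k| ≤ 1)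
    (i : Fin N) (s : ℝ) :
    Measurable fun p : ℝ × Ω => compensatedIncrement q y i p.1 s p.2 := by
  have h : (fun p : ℝ × Ω => compensatedIncrement q y i p.1 s p.2) = fun p =>
      y s p.2 i - y p.1 p.2 i -
        (pathIntegral (q i) y 0 s p.2 - pathIntegral (q i) y 0 p.1 p.2) := by
    ext p
    rw [compensatedIncrement, ← pathIntegral_add_adjacent (hq i) hym hy1 0 p.1 s p.2]
    ring
  rw [h]
  have hys : Measurable fun p : ℝ × Ω => y s p.2 i :=
    (hym i).comp (measurable_const.prodMk measurable_snd)
  have hVs : Measurable fun p : ℝ × Ω => pathIntegral (q i) y 0 s p.2 :=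
    (stronglyMeasurable_pathIntegral (hq i) hym 0 s).measurable.comp measurable_snd
  exact (hys.sub (hym i)).sub (hVs.sub (measurable_uncurry_pathIntegral (hq i) hym hy1 0))

theorem abs_compensatedIncrement_le (hq : ∀ i k, Integrable fun r => q i r k)
    (hy1 : ∀ r ω k, |y r ω k| ≤ 1) (i : Fin N) {u : ℝ} (htu : t ≤ u) (hus : u ≤ s) (hsT : s ≤ T)
    (ω : Ω) :
    |compensatedIncrement q y i u s ω| ≤ 2 + ∫ r in t..T, ∑ k, |q i r k| := by
  have h1 := abs_pathIntegral_le (hq i) hy1 htu hus hsT ω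
  have h2 := hy1 s ω i
  have h3 := hy1 u ω i
  rw [compensatedIncrement]
  rw [abs_le] at *
  constructor <;> linarith

theorem measurable_uncurry_exp_pathIntegral_mul_compensatedIncrement
    (hq : ∀ i k, Integrable fun r => q i r k) (hj : ∀ k, Integrable fun r => j r k)
    (hym : ∀ k, Measurable fun p : ℝ × Ω => y p.1 p.2 k) (hy1 : ∀ r ω k, |y r ω k| ≤ 1)
    (i k : Fin N) (t s : ℝ) :
    Measurable fun p : ℝ × Ω => Real.exp (pathIntegral j y t p.1 p.2) * y p.1 p.2 k *
      compensatedIncrement q y i p.1 s p.2 :=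
  (measurable_uncurry_exp_pathIntegral_mul hj hym hy1 t k).mul
    (measurable_uncurry_compensatedIncrement hq hym hy1 i s)

theorem abs_exp_pathIntegral_mul_compensatedIncrement_le
    (hq : ∀ i k, Integrable fun r => q i r k) (hj : ∀ k, Integrable fun r => j r k)
    (hy1 : ∀ r ω k, |y r ω k| ≤ 1) (i k : Fin N) {u : ℝ} (hu : u ∈ Set.Ioc t s) (ω : Ω) :
    |Real.exp (pathIntegral j y t u ω) * y u ω k * compensatedIncrement q y i u s ω| ≤
      Real.exp (∫ r in t..s, ∑ k, |j r k|) * (2 + ∫ r in t..s, ∑ k, |q i r k|) := by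
  rw [abs_mul]
  exact mul_le_mul (abs_exp_pathIntegral_mul_le hj hy1 (Set.Ioc_subset_Icc_self hu) ω k)
    (abs_compensatedIncrement_le hq hy1 i hu.1.le hu.2 le_rfl ω) (abs_nonneg _)
    (Real.exp_pos _).le

/-- Integration by parts for `exp (∫ ⟨j, y⟩) yᵢ` along a single path, written so that the noise
enters only through increments of the compensated coordinate over intervals `[u, s]`, each
weighted by a quantity known at time `u`. -/
theorem exp_pathIntegral_mul_eq (hym : ∀ k, Measurable fun p : ℝ × Ω => y p.1 p.2 k)
    (hstate : ∀ r ω, ∃ i, y r ω = Pi.single i 1) (hq : ∀ i k, Integrable fun r => q i r k)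
    (hj : ∀ k, Integrable fun r => j r k) (hts : t ≤ s) (i : Fin N) (ω : Ω) :
    Real.exp (pathIntegral j y t s ω) * y s ω i =
      y t ω i + compensatedIncrement q y i t s ω +
      (∫ u in t..s, j u i * (Real.exp (pathIntegral j y t u ω) * y u ω i)) +
      (∑ k, ∫ u in t..s, j u k *
        (Real.exp (pathIntegral j y t u ω) * y u ω k * compensatedIncrement q y i u s ω)) +
      ∑ k, ∫ u in t..s, q i u k * (Real.exp (pathIntegral j y t u ω) * y u ω k) := by
  have hy1 : ∀ r ω k, |y r ω k| ≤ 1 := fun r ω => abs_le_one_of_unitVector (hstate r ω)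
  have hEy := measurable_uncurry_exp_pathIntegral_mul hj hym hy1 t
  have hEyC : ∀ k, ∀ u ∈ Set.Ioc t s, ∀ ω, |Real.exp (pathIntegral j y t u ω) * y u ω k| ≤ _ :=
    fun k u hu ω => abs_exp_pathIntegral_mul_le hj hy1 (Set.Ioc_subset_Icc_self hu) ω k
  have hEyD := fun k =>
    measurable_uncurry_exp_pathIntegral_mul_compensatedIncrement hq hj hym hy1 i k t s
  have hEyDC := fun k u hu ω =>
    abs_exp_pathIntegral_mul_compensatedIncrement_le hq hj hy1 i k (t := t) (s := s) (u := u) hu ω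
  have h := exp_integral_mul_const_eq (integrable_dotProduct_path hj hym hy1 ω)
    (integrable_dotProduct_path (hq i) hym hy1 ω) hts (y s ω i)
  have h1 : ∫ u in t..s, (j u ⬝ᵥ y u ω) * Real.exp (∫ r in t..u, j r ⬝ᵥ y r ω) *
      (y s ω i - ∫ r in u..s, q i r ⬝ᵥ y r ω) =
      (∫ u in t..s, j u i * (Real.exp (pathIntegral j y t u ω) * y u ω i)) +
      ∑ k, ∫ u in t..s, j u k *
        (Real.exp (pathIntegral j y t u ω) * y u ω k * compensatedIncrement q y i u s ω) := by
    rw [← intervalIntegral.integral_finsetSum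
      fun k _ => intervalIntegrable_mul_path (hj k) (hEyD k) (hEyDC k) hts ω,
      ← intervalIntegral.integral_add
        (intervalIntegrable_mul_path (hj i) (hEy i) (hEyC i) hts ω)]
    · refine intervalIntegral.integral_congr fun u _ => ?_
      have hdot := dotProduct_mul_of_unitVector (hstate u ω) (j u) i
      have hsum : ∑ k, j u k * (Real.exp (pathIntegral j y t u ω) * y u ω k *
          compensatedIncrement q y i u s ω) = (j u ⬝ᵥ y u ω) *
            (Real.exp (pathIntegral j y t u ω) * compensatedIncrement q y i u s ω) := by
        rw [dotProduct, Finset.sum_mul]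
        exact Finset.sum_congr rfl fun k _ => by ring
      rw [hsum]
      change (j u ⬝ᵥ y u ω) * Real.exp (pathIntegral j y t u ω) *
        (y s ω i - pathIntegral (q i) y u s ω) = _
      rw [compensatedIncrement]
      linear_combination Real.exp (pathIntegral j y t u ω) * hdot
    · refine (IntervalIntegrable.sum Finset.univ fun k _ =>
        intervalIntegrable_mul_path (hj k) (hEyD k) (hEyDC k) hts ω).congr fun u _ => ?_
      rw [Finset.sum_apply]
  have h2 : ∫ u in t..s, Real.exp (∫ r in t..u, j r ⬝ᵥ y r ω) * (q i u ⬝ᵥ y u ω) =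
      ∑ k, ∫ u in t..s, q i u k * (Real.exp (pathIntegral j y t u ω) * y u ω k) := by
    rw [← intervalIntegral.integral_finsetSum
      fun k _ => intervalIntegrable_mul_path (hq i k) (hEy k) (hEyC k) hts ω]
    refine intervalIntegral.integral_congr fun u _ => ?_
    rw [dotProduct, Finset.mul_sum]
    exact Finset.sum_congr rfl fun k _ => by rw [pathIntegral]; ring
  rw [h1, h2] at h
  change Real.exp (pathIntegral j y t s ω) * y s ω i =
    (y s ω i - pathIntegral (q i) y t s ω) + _ + _
    at h
  rw [h, compensatedIncrement]
  ring

/-- The expectations `z(s) = 𝔼[exp (∫ₜˢ ⟨j, y⟩) y(s)]` solve `z' = (q + diag j) z`. Taking for `ν`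
the restriction of the underlying probability to an event of `𝒢 t` gives the conditional version.
-/
theorem integral_exp_pathIntegral_mul_eq {ν : Measure Ω} [IsFiniteMeasure ν] {𝒢 : Filtration ℝ mΩ}
    (hadapt : ∀ r k, Measurable[𝒢 r] fun ω => y r ω k)
    (hright : ∀ ω r, ContinuousWithinAt (fun u => y u ω) (Set.Ici r) r)
    (hstate : ∀ r ω, ∃ i, y r ω = Pi.single i 1) (hq : ∀ i k, Integrable fun r => q i r k)
    (hj : ∀ k, Integrable fun r => j r k)
    (hmart : ∀ u s, t ≤ u → u ≤ s → s ≤ T → ∀ i B, MeasurableSet[𝒢 u] B →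
      ∫ ω in B, compensatedIncrement q y i u s ω ∂ν = 0)
    (hs : s ∈ Set.Icc t T) (i : Fin N) :
    ∫ ω, Real.exp (pathIntegral j y t s ω) * y s ω i ∂ν =
      ∫ ω, y t ω i ∂ν +
      (∫ u in t..s, j u i * ∫ ω, Real.exp (pathIntegral j y t u ω) * y u ω i ∂ν) +
      ∑ k, ∫ u in t..s, q i u k * ∫ ω, Real.exp (pathIntegral j y t u ω) * y u ω k ∂ν := by
  have hy1 : ∀ r ω k, |y r ω k| ≤ 1 := fun r ω => abs_le_one_of_unitVector (hstate r ω)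
  have hym := measurable_uncurry_path hadapt hright
  have hEy := measurable_uncurry_exp_pathIntegral_mul hj hym hy1 t
  have hEyC : ∀ k, ∀ u ∈ Set.Ioc t s, ∀ ω, |Real.exp (pathIntegral j y t u ω) * y u ω k| ≤ _ :=
    fun k u hu ω => abs_exp_pathIntegral_mul_le hj hy1 (Set.Ioc_subset_Icc_self hu) ω k
  have hD := measurable_uncurry_compensatedIncrement hq hym hy1 i s
  have hEyD := fun k =>
    measurable_uncurry_exp_pathIntegral_mul_compensatedIncrement hq hj hym hy1 i k t s
  have hEyDC := fun k u hu ω =>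
    abs_exp_pathIntegral_mul_compensatedIncrement_le hq hj hy1 i k (t := t) (s := s) (u := u) hu ω
  have hDi : ∀ u ∈ Set.Icc t s, Integrable (compensatedIncrement q y i u s) ν := fun u hu =>
    Integrable.of_bound (hD.comp (measurable_const.prodMk measurable_id)).aestronglyMeasurable _
      (ae_of_all _ fun ω => abs_compensatedIncrement_le hq hy1 i hu.1 hu.2 le_rfl ω)
  -- the weight of the increment over `[u, s]` is known at time `u`
  have hzero : ∀ k, ∀ u ∈ Set.Ioc t s, ∫ ω, Real.exp (pathIntegral j y t u ω) * y u ω k *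
      compensatedIncrement q y i u s ω ∂ν = 0 := fun k u hu => by
    refine integral_mul_eq_zero_of_forall_setIntegral_eq_zero (𝒢.le u)
      (H := fun ω => Real.exp (pathIntegral j y t u ω) * y u ω k)
      (hDi u (Set.Ioc_subset_Icc_self hu)) ?_ ?_ (hmart u s hu.1.le hu.2 hs.2 i)
    · exact (Real.continuous_exp.comp_stronglyMeasurable
        (stronglyMeasurable_filtration_pathIntegral hj hadapt hright hu.1.le)).mul
          (hadapt u k).stronglyMeasurable
    · exact Integrable.of_bound
        ((hEyD k).comp (measurable_const.prodMk measurable_id)).aestronglyMeasurable _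
        (ae_of_all _ fun ω => hEyDC k u hu ω)
  have hyi : Integrable (fun ω => y t ω i) ν :=
    Integrable.of_bound ((hym i).comp (measurable_const.prodMk measurable_id)).aestronglyMeasurable
      1 (ae_of_all _ fun ω => hy1 t ω i)
  have hI1 := integrable_intervalIntegral_mul (ν := ν) (hj i) (hEy i) (hEyC i) hs.1
  have hI2 := fun k => integrable_intervalIntegral_mul (ν := ν) (hj k) (hEyD k) (hEyDC k) hs.1
  have hI3 := fun k => integrable_intervalIntegral_mul (ν := ν) (hq i k) (hEy k) (hEyC k) hs.1
  have hDt := hDi t ⟨le_rfl, hs.1⟩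
  have hDt0 : ∫ ω, compensatedIncrement q y i t s ω ∂ν = 0 := by
    simpa using hmart t s le_rfl hs.1 hs.2 i Set.univ MeasurableSet.univ
  have hadd : ∀ {f₁ f₂ f₃ f₄ f₅ : Ω → ℝ}, Integrable f₁ ν → Integrable f₂ ν → Integrable f₃ ν →
      Integrable f₄ ν → Integrable f₅ ν → ∫ ω, f₁ ω + f₂ ω + f₃ ω + f₄ ω + f₅ ω ∂ν =
        ∫ ω, f₁ ω ∂ν + ∫ ω, f₂ ω ∂ν + ∫ ω, f₃ ω ∂ν + ∫ ω, f₄ ω ∂ν + ∫ ω, f₅ ω ∂ν := by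
    intro f₁ f₂ f₃ f₄ f₅ h₁ h₂ h₃ h₄ h₅
    rw [← integral_add' h₁ h₂, ← integral_add' (h₁.add h₂) h₃,
      ← integral_add' ((h₁.add h₂).add h₃) h₄, ← integral_add' (((h₁.add h₂).add h₃).add h₄) h₅]
    rfl
  simp_rw [exp_pathIntegral_mul_eq hym hstate hq hj hs.1 i]
  rw [hadd hyi hDt hI1 (integrable_finsetSum Finset.univ fun k _ => hI2 k)
      (integrable_finsetSum Finset.univ fun k _ => hI3 k),
    integral_finsetSum _ fun k _ => hI2 k, integral_finsetSum _ fun k _ => hI3 k, hDt0,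
    integral_intervalIntegral_mul (hj i) (hEy i) (hEyC i) hs.1]
  have hI2z : ∑ k, ∫ ω, (∫ u in t..s, j u k * (Real.exp (pathIntegral j y t u ω) * y u ω k *
      compensatedIncrement q y i u s ω)) ∂ν = 0 := by
    refine Finset.sum_eq_zero fun k _ => ?_
    rw [integral_intervalIntegral_mul (hj k) (hEyD k) (hEyDC k) hs.1]
    refine intervalIntegral.integral_zero_ae (ae_of_all _ fun u hu => ?_)
    rw [Set.uIoc_of_le hs.1] at hu
    rw [hzero k u hu, mul_zero]
  rw [hI2z, add_zero, add_zero]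
  congr 1
  exact Finset.sum_congr rfl fun k _ =>
    integral_intervalIntegral_mul (hq i k) (hEy k) (hEyC k) hs.1

end FeynmanKac

/-! ### The conditional expectation formula and independent enlargement -/

section ConditionalExpectation

variable {Ω : Type*} {N : ℕ} {mΩ : MeasurableSpace Ω} {y : ℝ → Ω → Fin N → ℝ}
  {q : Fin N → ℝ → Fin N → ℝ} {j : ℝ → Fin N → ℝ} {t T s : ℝ}

/-- The conditional expectation formula for a process indexed by the real line. On each event of
`𝒢 t`, the expectations of `exp (∫ ⟨j, y⟩) y` solve the linear equation, hence are the time-ordered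
exponential applied to the expectation of `y t`; the coordinates of `y T` add up to one. -/
theorem condExp_exp_pathIntegral {μ : Measure Ω} [IsFiniteMeasure μ] {𝒢 : Filtration ℝ mΩ}
    (hadapt : ∀ r k, Measurable[𝒢 r] fun ω => y r ω k)
    (hright : ∀ ω r, ContinuousWithinAt (fun u => y u ω) (Set.Ici r) r)
    (hstate : ∀ r ω, ∃ i, y r ω = Pi.single i 1) (hq : ∀ i k, Integrable fun r => q i r k)
    (hj : ∀ k, Integrable fun r => j r k) (htT : t ≤ T)
    (hmart : ∀ u s, t ≤ u → u ≤ s → s ≤ T → ∀ i B, MeasurableSet[𝒢 u] B →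
      ∫ ω in B, compensatedIncrement q y i u s ω ∂μ = 0)
    {A : ℝ → Matrix (Fin N) (Fin N) ℝ}
    (hA : ∀ u ∈ Set.Ioc t T, A u = Matrix.of (fun i k => q i u k) + Matrix.diagonal (j u)) :
    Integrable (fun ω => Real.exp (pathIntegral j y t T ω)) μ ∧
      μ[fun ω => Real.exp (pathIntegral j y t T ω) | 𝒢 t] =ᵐ[μ]
        fun ω => (timeOrderedExp A t T *ᵥ y t ω) ⬝ᵥ 1 := by
  have hy1 : ∀ r ω k, |y r ω k| ≤ 1 := fun r ω => abs_le_one_of_unitVector (hstate r ω)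
  have hym := measurable_uncurry_path hadapt hright
  have hEy := measurable_uncurry_exp_pathIntegral_mul hj hym hy1 t
  have hEyC : ∀ k, ∀ u ∈ Set.Ioc t T, ∀ ω, |Real.exp (pathIntegral j y t u ω) * y u ω k| ≤ _ :=
    fun k u hu ω => abs_exp_pathIntegral_mul_le hj hy1 (Set.Ioc_subset_Icc_self hu) ω k
  set c : Fin N → Fin N → ℝ → ℝ := fun i k u => q i u k + Matrix.diagonal (j u) i k
  have hc : ∀ i k, Integrable (c i k) := fun i k => by
    refine (hq i k).add ?_
    by_cases h : i = k
    · subst h; simpa using hj i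
    · simp [h]
  have hAc : ∀ u ∈ Set.Ioc t T, ∀ i k, A u i k = c i k u := fun u hu i k => by
    rw [hA u hu]; rfl
  have hAint : ∀ i k, IntervalIntegrable (fun u => A u i k) volume t T := fun i k =>
    (hc i k).intervalIntegrable.congr fun u hu => by
      rw [Set.uIoc_of_le htT] at hu
      exact (hAc u hu i k).symm
  have hEint : Integrable (fun ω => Real.exp (pathIntegral j y t T ω)) μ :=
    Integrable.of_bound (Real.continuous_exp.comp_stronglyMeasurable
      (stronglyMeasurable_pathIntegral hj hym t T)).aestronglyMeasurable _
      (ae_of_all _ fun ω => exp_pathIntegral_le hj hy1 ⟨htT, le_rfl⟩ ω)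
  have hyint : ∀ k, Integrable (fun ω => y t ω k) μ := fun k =>
    Integrable.of_bound ((hym k).comp (measurable_const.prodMk measurable_id)).aestronglyMeasurable
      1 (ae_of_all _ fun ω => hy1 t ω k)
  have hEyint : ∀ k, Integrable (fun ω => Real.exp (pathIntegral j y t T ω) * y T ω k) μ :=
    fun k => hEint.mul_bdd (c := 1)
      ((hym k).comp (measurable_const.prodMk measurable_id)).aestronglyMeasurable
      (ae_of_all _ fun ω => hy1 T ω k)
  have hdot : ∀ ω, (timeOrderedExp A t T *ᵥ y t ω) ⬝ᵥ 1 =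
      ∑ i, ∑ k, timeOrderedExp A t T i k * y t ω k := fun ω => by
    simp only [dotProduct, Matrix.mulVec, Pi.one_apply, mul_one]
  have hGint : Integrable (fun ω => (timeOrderedExp A t T *ᵥ y t ω) ⬝ᵥ 1) μ := by
    simp_rw [hdot]
    exact integrable_finsetSum _ fun i _ => integrable_finsetSum _ fun k _ =>
      (hyint k).const_mul _
  refine ⟨hEint, (ae_eq_condExp_of_forall_setIntegral_eq (𝒢.le t) hEint
    (fun B _ _ => hGint.integrableOn) (fun B hB _ => ?_) ?_).symm⟩
  · set ν := μ.restrict B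
    set z : ℝ → Fin N → ℝ := fun u k => ∫ ω, Real.exp (pathIntegral j y t u ω) * y u ω k ∂ν
      with hz
    have hzt : ∀ k, z t k = ∫ ω, y t ω k ∂ν := fun k => by
      simp [hz, pathIntegral]
    have hzint : ∀ i k, IntervalIntegrable (fun u => c i k u * z u k) volume t T := fun i k =>
      intervalIntegrable_mul_expectation (hc i k) (hEy k) (hEyC k) htT
    have hmart' : ∀ u s, t ≤ u → u ≤ s → s ≤ T → ∀ i B', MeasurableSet[𝒢 u] B' →
        ∫ ω in B', compensatedIncrement q y i u s ω ∂ν = 0 := fun u s htu hus hsT i B' hB' => by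
      rw [Measure.restrict_restrict (𝒢.le u _ hB')]
      exact hmart u s htu hus hsT i _ (hB'.inter (𝒢.mono htu _ hB))
    have hzbound : ∀ u ∈ Set.Icc t T, ‖z u‖ ≤
        Real.exp (∫ r in t..T, ∑ k, |j r k|) * ν.real Set.univ := fun u hu => by
      refine (pi_norm_le_iff_of_nonneg (by positivity)).2 fun k => ?_
      exact norm_integral_le_of_norm_le_const
        (ae_of_all _ fun ω => abs_exp_pathIntegral_mul_le hj hy1 hu ω k)
    have hode : ∀ u ∈ Set.Icc t T, ∀ i, z u i = z t i + ∫ r in t..u, (A r *ᵥ z r) i := by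
      intro u hu i
      have hsub : Set.Ioc t u ⊆ Set.Ioc t T := Set.Ioc_subset_Ioc_right hu.2
      have hjz := intervalIntegrable_mul_expectation (ν := ν) (hj i) (hEy i)
        (fun r hr => hEyC i r (hsub hr)) hu.1
      have hqz := fun k => intervalIntegrable_mul_expectation (ν := ν) (hq i k) (hEy k)
        (fun r hr => hEyC k r (hsub hr)) hu.1
      rw [hzt, hz]
      beta_reduce
      rw [integral_exp_pathIntegral_mul_eq hadapt hright hstate hq hj hmart' hu i, add_assoc,
        ← intervalIntegral.integral_finsetSum fun k _ => hqz k,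
        ← intervalIntegral.integral_add hjz]
      · congr 1
        refine intervalIntegral.integral_congr_ae (ae_of_all _ fun r hr => ?_)
        rw [Set.uIoc_of_le hu.1] at hr
        rw [hA r (hsub hr), Matrix.add_mulVec, Pi.add_apply, Matrix.mulVec_diagonal, add_comm]
        rfl
      · refine (IntervalIntegrable.sum Finset.univ fun k _ => hqz k).congr fun r _ => ?_
        rw [Finset.sum_apply]
    have hzA : ∀ i k, IntervalIntegrable (fun u => A u i k * z u k) volume t T := fun i k =>
      (hzint i k).congr fun u hu => by
        rw [Set.uIoc_of_le htT] at hu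
        rw [hAc u hu i k]
    have hsol := eq_timeOrderedExp_mulVec htT hAint hzbound hzA hode ⟨htT, le_rfl⟩
    have hsum : ∀ ω, Real.exp (pathIntegral j y t T ω) =
        ∑ i, Real.exp (pathIntegral j y t T ω) * y T ω i := fun ω => by
      obtain ⟨i, hi⟩ := hstate T ω
      rw [← Finset.mul_sum, hi, Finset.sum_pi_single']
      simp
    have hyν : ∀ i k, Integrable (fun ω => timeOrderedExp A t T i k * y t ω k) ν :=
      fun i k => ((hyint k).const_mul _).restrict
    simp_rw [hdot]
    rw [integral_congr_ae (ae_of_all _ hsum), integral_finsetSum _ fun i _ => (hEyint i).restrict,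
      integral_finsetSum _ fun i _ => integrable_finsetSum _ fun k _ => hyν i k]
    refine Finset.sum_congr rfl fun i _ => ?_
    rw [integral_finsetSum _ fun k _ => hyν i k]
    change _ = z T i
    rw [hsol, Matrix.mulVec, dotProduct]
    exact Finset.sum_congr rfl fun k _ => by rw [integral_const_mul, hzt]
  · simp_rw [hdot]
    refine StronglyMeasurable.aestronglyMeasurable ?_
    refine Finset.stronglyMeasurable_fun_sum _ fun i _ =>
      Finset.stronglyMeasurable_fun_sum _ fun k _ => ?_
    exact (hadapt t k).stronglyMeasurable.const_mul _

/-- Enlarging `m₂` by a `σ`-algebra `m₁` independent of `m₂'` preserves `𝔼[D | m₂] = 0` when `D` is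
`m₂'`-measurable: the events `B₁ ∩ B₂` form a generating `π`-system, on which independence
factors out `B₁`. -/
theorem setIntegral_eq_zero_of_indep {μ : Measure Ω} [IsProbabilityMeasure μ]
    {m₁ m₂ m₂' : MeasurableSpace Ω} (h₁ : m₁ ≤ mΩ) (h₂ : m₂ ≤ m₂') (h₂' : m₂' ≤ mΩ)
    (hindep : Indep m₁ m₂' μ) {D : Ω → ℝ} (hDm : StronglyMeasurable[m₂'] D) (hD : Integrable D μ)
    (h0 : ∀ B, MeasurableSet[m₂] B → ∫ ω in B, D ω ∂μ = 0) {B : Set Ω}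
    (hB : MeasurableSet[m₁ ⊔ m₂] B) : ∫ ω in B, D ω ∂μ = 0 := by
  set S : Set (Set Ω) :=
    Set.image2 (· ∩ ·) {B₁ | MeasurableSet[m₁] B₁} {B₂ | MeasurableSet[m₂] B₂}
  have hle : m₁ ⊔ m₂ ≤ mΩ := sup_le h₁ (h₂.trans h₂')
  have hgen : m₁ ⊔ m₂ = MeasurableSpace.generateFrom S := by
    refine le_antisymm (sup_le (fun B₁ hB₁ => ?_) fun B₂ hB₂ => ?_)
      (MeasurableSpace.generateFrom_le ?_)
    · exact MeasurableSpace.measurableSet_generateFrom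
        ⟨B₁, hB₁, Set.univ, MeasurableSet.univ, Set.inter_univ _⟩
    · exact MeasurableSpace.measurableSet_generateFrom
        ⟨Set.univ, MeasurableSet.univ, B₂, hB₂, Set.univ_inter _⟩
    · rintro _ ⟨B₁, hB₁, B₂, hB₂, rfl⟩
      exact MeasurableSet.inter ((le_sup_left : m₁ ≤ m₁ ⊔ m₂) _ hB₁)
        ((le_sup_right : m₂ ≤ m₁ ⊔ m₂) _ hB₂)
  have hpi : IsPiSystem S := by
    rintro _ ⟨B₁, hB₁, B₂, hB₂, rfl⟩ _ ⟨C₁, hC₁, C₂, hC₂, rfl⟩ _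
    exact ⟨B₁ ∩ C₁, MeasurableSet.inter hB₁ hC₁, B₂ ∩ C₂, MeasurableSet.inter hB₂ hC₂,
      Set.inter_inter_inter_comm _ _ _ _⟩
  have hbasic : ∀ B₁, MeasurableSet[m₁] B₁ → ∀ B₂, MeasurableSet[m₂] B₂ →
      ∫ ω in B₁ ∩ B₂, D ω ∂μ = 0 := fun B₁ hB₁ B₂ hB₂ => by
    have hB₂' := h₂' _ (h₂ _ hB₂)
    have hf : StronglyMeasurable[m₂'] (B₂.indicator D) := hDm.indicator (h₂ _ hB₂)
    rw [← setIntegral_indicator hB₂',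
      ← setIntegral_condExp h₁ (hD.indicator hB₂') hB₁,
      integral_congr_ae (ae_restrict_of_ae (condExp_indep_eq h₂' h₁ hf hindep.symm)),
      integral_indicator hB₂', h0 B₂ hB₂]
    simp
  have huniv : ∫ ω, D ω ∂μ = 0 := by
    simpa using hbasic Set.univ MeasurableSet.univ Set.univ MeasurableSet.univ
  induction B, hB using MeasurableSpace.induction_on_inter hgen hpi with
  | empty => simp
  | basic B hB =>
    obtain ⟨B₁, hB₁, B₂, hB₂, rfl⟩ := hB
    exact hbasic B₁ hB₁ B₂ hB₂
  | compl B hB ih =>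
    have h := integral_add_compl (hle _ hB) hD
    rw [ih, huniv, zero_add] at h
    exact h
  | iUnion f hdisj hf ih =>
    rw [integral_iUnion (fun n => hle _ (hf n)) hdisj hD.integrableOn]
    simp [ih]

end ConditionalExpectation

/-! ### From the time interval `[0, T]` to the real line -/

section Extension

variable {Ω : Type*} {mΩ : MeasurableSpace Ω}

theorem enlargedFiltration_le_sup {N : ℕ} {T : ℝ} {W : Fin 3 → ℝ → Ω → ℝ} {X : ℝ → Ω → Fin N → ℝ}
    (hW : ∀ i, ∀ s : Set.Icc (0 : ℝ) T, StronglyMeasurable (W i s))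
    (hX : ∀ s : Set.Icc (0 : ℝ) T, StronglyMeasurable (X s)) (u : Set.Icc (0 : ℝ) T) :
    enlargedFiltration T W X hW hX u ≤
      MeasurableSpace.comap (fun ω (p : Fin 3 × Set.Icc (0 : ℝ) T) => W p.1 p.2 ω)
        MeasurableSpace.pi ⊔ naturalFiltration T X hX u := by
  have h : ∀ i, naturalFiltration T (W i) (hW i) u ≤
      MeasurableSpace.comap (fun ω (p : Fin 3 × Set.Icc (0 : ℝ) T) => W p.1 p.2 ω)
        MeasurableSpace.pi := fun i => by
    refine iSup₂_le fun v _ => ?_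
    rw [← measurable_iff_comap_le]
    exact (measurable_pi_apply (X := fun _ : Fin 3 × Set.Icc (0 : ℝ) T => ℝ) (i, v)).comp
      (comap_measurable _)
  exact sup_le_sup (sup_le (sup_le (h 0) (h 1)) (h 2)) le_rfl

theorem naturalFiltration_le_comap {N : ℕ} {T : ℝ} {X : ℝ → Ω → Fin N → ℝ}
    (hX : ∀ s : Set.Icc (0 : ℝ) T, StronglyMeasurable (X s)) (u : Set.Icc (0 : ℝ) T) :
    naturalFiltration T X hX u ≤
      MeasurableSpace.comap (fun ω (s : Set.Icc (0 : ℝ) T) => X s ω) MeasurableSpace.pi := by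
  refine iSup₂_le fun v _ => ?_
  rw [← measurable_iff_comap_le]
  exact (measurable_pi_apply (X := fun _ : Set.Icc (0 : ℝ) T => Fin N → ℝ) v).comp
    (comap_measurable _)

theorem setIntegral_martingale_increment_eq_zero {N : ℕ} {ι : Type*} [Preorder ι] {μ : Measure Ω}
    [IsFiniteMeasure μ] {ℱ : Filtration ι mΩ} {M : ι → Ω → Fin N → ℝ} (hM : Martingale M ℱ μ)
    {u s : ι} (hus : u ≤ s) (i : Fin N) {B : Set Ω} (hB : MeasurableSet[ℱ u] B) :
    ∫ ω in B, (M s ω i - M u ω i) ∂μ = 0 := by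
  have hi : ∀ r, Integrable (fun ω => M r ω i) μ := fun r => (hM.integrable r).eval i
  rw [integral_sub (hi s).restrict (hi u).restrict, sub_eq_zero,
    ← eval_integral fun i => ((hM.integrable s).eval i).restrict,
    ← eval_integral fun i => ((hM.integrable u).eval i).restrict, hM.setIntegral_eq hus hB]

/-- Under either hypothesis on the martingale part, its increments are centred on the events of the
enlarged filtration. -/
theorem setIntegral_martingalePart_increment_eq_zero {μ : Measure Ω} [IsProbabilityMeasure μ]
    {N : ℕ} {T : ℝ}
    {W : Fin 3 → ℝ → Ω → ℝ} {X : ℝ → Ω → Fin N → ℝ}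
    (hW : ∀ i, ∀ s : Set.Icc (0 : ℝ) T, StronglyMeasurable (W i s))
    (hX : ∀ s : Set.Icc (0 : ℝ) T, StronglyMeasurable (X s))
    {M : Set.Icc (0 : ℝ) T → Ω → Fin N → ℝ}
    (hM : Martingale M (enlargedFiltration T W X hW hX) μ ∨
      (Martingale M (naturalFiltration T X hX) μ ∧
        IndepFun (fun ω (p : Fin 3 × Set.Icc (0 : ℝ) T) => W p.1 p.2 ω)
          (fun ω (s : Set.Icc (0 : ℝ) T) => X s ω) μ))
    {u s : Set.Icc (0 : ℝ) T} (hus : u ≤ s) (i : Fin N) {B : Set Ω}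
    (hB : MeasurableSet[enlargedFiltration T W X hW hX u] B) :
    ∫ ω in B, (M s ω i - M u ω i) ∂μ = 0 := by
  rcases hM with hM | ⟨hM, hindep⟩
  · exact setIntegral_martingale_increment_eq_zero hM hus i hB
  · have hXm : Measurable fun ω (s : Set.Icc (0 : ℝ) T) => X s ω :=
      measurable_pi_lambda _ fun s => (hX s).measurable
    have hWm : Measurable fun ω (p : Fin 3 × Set.Icc (0 : ℝ) T) => W p.1 p.2 ω :=
      measurable_pi_lambda _ fun p => (hW p.1 p.2).measurable
    have hMm : ∀ r, StronglyMeasurable[MeasurableSpace.comap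
        (fun ω (s : Set.Icc (0 : ℝ) T) => X s ω) MeasurableSpace.pi] fun ω => M r ω i := fun r =>
      (continuous_apply i).comp_stronglyMeasurable
        ((hM.stronglyMeasurable r).mono (naturalFiltration_le_comap hX r))
    exact setIntegral_eq_zero_of_indep hWm.comap_le (naturalFiltration_le_comap hX u) hXm.comap_le
      hindep ((hMm s).sub (hMm u)) (((hM.integrable s).eval i).sub ((hM.integrable u).eval i))
      (fun B hB => setIntegral_martingale_increment_eq_zero hM hus i hB)
      (enlargedFiltration_le_sup hW hX u _ hB)

/-- The filtration on `ℝ` that extends one on `[0, T]` by constancy on either side. -/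
noncomputable def extendFiltration {T : ℝ} (hT : 0 ≤ T) (ℱ : Filtration (Set.Icc (0 : ℝ) T) mΩ) :
    Filtration ℝ mΩ where
  seq r := ℱ (Set.projIcc 0 T hT r)
  mono' _ _ h := ℱ.mono (Set.monotone_projIcc hT h)
  le' _ := ℱ.le _

theorem continuousWithinAt_comp_projIcc {E : Type*} [TopologicalSpace E] {T : ℝ} (hT : 0 ≤ T)
    {f : ℝ → E} (hf : ∀ s ∈ Set.Ico (0 : ℝ) T, ContinuousWithinAt f (Set.Icc s T) s) (r : ℝ) :
    ContinuousWithinAt (fun u => f (Set.projIcc 0 T hT u)) (Set.Ici r) r := by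
  have hc : ContinuousWithinAt (fun u => (Set.projIcc 0 T hT u : ℝ)) (Set.Ici r) r :=
    (continuous_subtype_val.comp continuous_projIcc).continuousWithinAt
  have hmaps : Set.MapsTo (fun u => (Set.projIcc 0 T hT u : ℝ)) (Set.Ici r)
      (Set.Icc (Set.projIcc 0 T hT r : ℝ) T) :=
    fun u hu => ⟨Set.monotone_projIcc hT hu, (Set.projIcc 0 T hT u).2.2⟩
  refine ContinuousWithinAt.comp (g := f) (t := Set.Icc (Set.projIcc 0 T hT r : ℝ) T) ?_ hc hmaps
  -- at the terminal time the interval degenerates to a point and nothing is assumed of `f`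
  rcases (Set.projIcc 0 T hT r).2.2.lt_or_eq with h | h
  · exact hf _ ⟨(Set.projIcc 0 T hT r).2.1, h⟩
  · rw [h, Set.Icc_self]
    exact continuousWithinAt_singleton

end Extension

theorem proposition2 {Ω : Type*} [mΩ : MeasurableSpace Ω]
    -- the `T`-forward measure
    (μ : Measure Ω) [IsProbabilityMeasure μ]
    (N : ℕ) (T : ℝ)
    -- the driving noises and the chain, on the time interval `[0, T]`
    (W : Fin 3 → ℝ → Ω → ℝ) (X : ℝ → Ω → Fin N → ℝ)
    (hW : ∀ i, ∀ s : Set.Icc (0 : ℝ) T, StronglyMeasurable (W i s))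
    (hX : ∀ s : Set.Icc (0 : ℝ) T, StronglyMeasurable (X s))
    -- the state space is the set of unit vectors, and paths are right-continuous
    (hXstate : ∀ s ∈ Set.Icc (0 : ℝ) T, ∀ ω, ∃ i : Fin N, X s ω = Pi.single i 1)
    (hXright : ∀ ω, ∀ s ∈ Set.Ico (0 : ℝ) T,
      ContinuousWithinAt (fun u => X u ω) (Set.Icc s T) s)
    -- the semimartingale dynamics `X(s) = X(0) + ∫₀ˢ Q(u) X(u) du + M(s)`
    (Q : ℝ → Matrix (Fin N) (Fin N) ℝ)
    (hQ : ∀ i j, IntervalIntegrable (fun s => Q s i j) volume 0 T)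
    (M : ℝ → Ω → Fin N → ℝ)
    (hdyn : ∀ s ∈ Set.Icc (0 : ℝ) T, ∀ᵐ ω ∂μ,
      X s ω = X 0 ω + (∫ u in (0 : ℝ)..s, Q u *ᵥ X u ω) + M s ω)
    -- `M` is a martingale in the enlarged filtration, or it is one in the filtration of the
    -- chain and the noises are independent of the chain
    (hM : Martingale (fun s : Set.Icc (0 : ℝ) T => M s) (enlargedFiltration T W X hW hX) μ ∨
      (Martingale (fun s : Set.Icc (0 : ℝ) T => M s) (naturalFiltration T X hX) μ ∧
        IndepFun (fun ω (p : Fin 3 × Set.Icc (0 : ℝ) T) => W p.1 p.2 ω)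
          (fun ω (s : Set.Icc (0 : ℝ) T) => X s ω) μ))
    (J : ℝ → Fin N → ℝ)
    (hJ : ∀ i, IntervalIntegrable (fun s => J s i) volume 0 T)
    (t : ℝ) (ht : t ∈ Set.Icc (0 : ℝ) T)
    (A : ℝ → Matrix (Fin N) (Fin N) ℝ)
    (hA : ∀ s, A s = Q s + Matrix.diagonal (J s)) :
    -- the series defining `Φ(t, s)` converges
    (∀ s ∈ Set.Icc t T, Summable fun n => dysonTerm A t n s) ∧
    -- `Φ(t, ·)` is the unique solution of the linear matrix ODE
    IsFundamentalSolution A t T (timeOrderedExp A t) ∧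
    (∀ Ψ : ℝ → Matrix (Fin N) (Fin N) ℝ, IsFundamentalSolution A t T Ψ →
      Set.EqOn Ψ (timeOrderedExp A t) (Set.Icc t T)) ∧
    -- the ODE holds in the classical sense wherever its coefficients are continuous
    (∀ s ∈ Set.Icc t T, ContinuousWithinAt A (Set.Icc t T) s → ∀ i j,
      HasDerivWithinAt (fun u => timeOrderedExp A t u i j)
        ((A s * timeOrderedExp A t s) i j) (Set.Icc t T) s) ∧
    -- if the coefficient matrices commute, `Φ(t, T)` is the exponential of the integral
    ((∀ s ∈ Set.Icc t T, ∀ u ∈ Set.Icc t T, Commute (A s) (A u)) →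
      timeOrderedExp A t T =
        NormedSpace.exp (Matrix.of fun i j => ∫ s in t..T, A s i j)) ∧
    -- the conditional expectation formula
    Integrable (fun ω => Real.exp (∫ s in t..T, J s ⬝ᵥ X s ω)) μ ∧
    μ[fun ω => Real.exp (∫ s in t..T, J s ⬝ᵥ X s ω) |
        enlargedFiltration T W X hW hX ⟨t, ht⟩]
      =ᵐ[μ] fun ω => (timeOrderedExp A t T *ᵥ X t ω) ⬝ᵥ 1 := by
  have htT : t ≤ T := ht.2
  have hT : 0 ≤ T := ht.1.trans htT
  have hAint : ∀ i k, IntervalIntegrable (fun s => A s i k) volume t T := fun i k => by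
    have h : IntervalIntegrable (fun s => A s i k) volume 0 T := by
      have hdiag : IntervalIntegrable (fun s => Matrix.diagonal (J s) i k) volume 0 T := by
        by_cases hik : i = k
        · subst hik; simpa using hJ i
        · simp [hik]
      refine ((hQ i k).add hdiag).congr fun s _ => ?_
      rw [hA s]; rfl
    exact h.mono_set (by
      rw [Set.uIcc_of_le htT, Set.uIcc_of_le hT]; exact Set.Icc_subset_Icc_left ht.1)
  refine ⟨fun s hs => summable_dysonTerm htT hAint hs,
    isFundamentalSolution_timeOrderedExp htT hAint,
    fun Ψ hΨ => hΨ.eqOn_timeOrderedExp htT hAint,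
    fun s hs hAs i k => hasDerivWithinAt_timeOrderedExp htT hAint hs hAs i k,
    fun hcomm => timeOrderedExp_eq_exp htT hAint hcomm, ?_⟩
  -- extend the chain by constancy, and the coefficients by zero, beyond `[0, T]`
  set y : ℝ → Ω → Fin N → ℝ := fun r ω => X (Set.projIcc 0 T hT r) ω with hy
  set q : Fin N → ℝ → Fin N → ℝ := fun i => (Set.Ioc 0 T).indicator fun r => Q r i with hqdef
  set j : ℝ → Fin N → ℝ := (Set.Ioc 0 T).indicator J with hjdef
  set 𝒢 := extendFiltration hT (enlargedFiltration T W X hW hX) with h𝒢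
  have hyX : ∀ r ∈ Set.Icc (0 : ℝ) T, y r = X r := fun r hr => by
    rw [hy]; simp only [Set.projIcc_of_mem hT hr]
  have hcut : ∀ {f : ℝ → Fin N → ℝ}, (∀ k, IntervalIntegrable (fun r => f r k) volume 0 T) →
      ∀ k, Integrable fun r => (Set.Ioc 0 T).indicator f r k := fun {f} hf k => by
    have h := IntegrableOn.integrable_indicator
      ((intervalIntegrable_iff_integrableOn_Ioc_of_le hT).1 (hf k)) measurableSet_Ioc
    refine h.congr (ae_of_all _ fun r => ?_)
    by_cases hr : r ∈ Set.Ioc 0 T <;> simp [hr]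
  have hq : ∀ i k, Integrable fun r => q i r k := fun i => hcut (hQ i)
  have hj : ∀ k, Integrable fun r => j r k := hcut hJ
  have hadapt : ∀ r k, Measurable[𝒢 r] fun ω => y r ω k := fun r k => by
    have h1 : Measurable[naturalFiltration T X hX (Set.projIcc 0 T hT r)] (y r) :=
      ((Filtration.stronglyAdapted_natural hX) (Set.projIcc 0 T hT r)).measurable
    exact (measurable_pi_apply k).comp (h1.mono le_sup_right le_rfl)
  have hright : ∀ ω r, ContinuousWithinAt (fun u => y u ω) (Set.Ici r) r := fun ω r =>
    continuousWithinAt_comp_projIcc hT (hXright ω) r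
  have hstate : ∀ r ω, ∃ i, y r ω = Pi.single i 1 := fun r ω =>
    hXstate _ (Set.projIcc 0 T hT r).2 ω
  have hy1 : ∀ r ω k, |y r ω k| ≤ 1 := fun r ω => abs_le_one_of_unitVector (hstate r ω)
  have hym := measurable_uncurry_path hadapt hright
  have hdrift : ∀ s ∈ Set.Icc (0 : ℝ) T, ∀ ω i,
      (∫ u in (0 : ℝ)..s, Q u *ᵥ X u ω) i = pathIntegral (q i) y 0 s ω := fun s hs ω i => by
    have hcongr : ∫ u in (0 : ℝ)..s, Q u *ᵥ X u ω = ∫ u in (0 : ℝ)..s, fun i => q i u ⬝ᵥ y u ω := by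
      refine intervalIntegral.integral_congr_ae (ae_of_all _ fun u hu => ?_)
      rw [Set.uIoc_of_le hs.1] at hu
      have hu' : u ∈ Set.Ioc 0 T := ⟨hu.1, hu.2.trans hs.2⟩
      ext i
      rw [hyX u ⟨hu'.1.le, hu'.2⟩, hqdef]
      simp only [Set.indicator_of_mem hu']
      rfl
    have hvec : Integrable fun u (i : Fin N) => q i u ⬝ᵥ y u ω :=
      Integrable.of_eval fun i => integrable_dotProduct_path (hq i) hym hy1 ω
    rw [hcongr]
    exact ((ContinuousLinearMap.proj (R := ℝ) (φ := fun _ : Fin N => ℝ)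
      i).intervalIntegral_comp_comm hvec.intervalIntegrable).symm
  have hmart : ∀ u s, t ≤ u → u ≤ s → s ≤ T → ∀ i B, MeasurableSet[𝒢 u] B →
      ∫ ω in B, compensatedIncrement q y i u s ω ∂μ = 0 := fun u s htu hus hsT i B hB => by
    have hu : u ∈ Set.Icc (0 : ℝ) T := ⟨ht.1.trans htu, hus.trans hsT⟩
    have hs : s ∈ Set.Icc (0 : ℝ) T := ⟨hu.1.trans hus, hsT⟩
    have hB' : MeasurableSet[enlargedFiltration T W X hW hX ⟨u, hu⟩] B := by
      rw [← Set.projIcc_of_mem hT hu]; exact hB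
    rw [← setIntegral_martingalePart_increment_eq_zero hW hX hM
      (u := ⟨u, hu⟩) (s := ⟨s, hs⟩) hus i hB']
    refine integral_congr_ae (ae_restrict_of_ae ?_)
    filter_upwards [hdyn u hu, hdyn s hs] with ω hωu hωs
    have hu' := congr_fun hωu i
    have hs' := congr_fun hωs i
    simp only [Pi.add_apply] at hu' hs'
    rw [hdrift u hu] at hu'
    rw [hdrift s hs] at hs'
    have hadd := pathIntegral_add_adjacent (hq i) hym hy1 0 u s ω
    rw [compensatedIncrement, hyX u hu, hyX s hs]
    linarith
  have hAqj : ∀ u ∈ Set.Ioc t T,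
      A u = Matrix.of (fun i k => q i u k) + Matrix.diagonal (j u) := fun u hu => by
    have hu' : u ∈ Set.Ioc 0 T := ⟨ht.1.trans_lt hu.1, hu.2⟩
    rw [hA u, hjdef, hqdef]
    simp only [Set.indicator_of_mem hu']
    rfl
  have hexp : (fun ω => Real.exp (∫ s in t..T, J s ⬝ᵥ X s ω)) =
      fun ω => Real.exp (pathIntegral j y t T ω) := by
    ext ω
    congr 1
    refine intervalIntegral.integral_congr_ae (ae_of_all _ fun u hu => ?_)
    rw [Set.uIoc_of_le htT] at hu
    have hu' : u ∈ Set.Ioc 0 T := ⟨ht.1.trans_lt hu.1, hu.2⟩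
    rw [hyX u ⟨hu'.1.le, hu'.2⟩, hjdef, Set.indicator_of_mem hu']
  have hfinal := condExp_exp_pathIntegral hadapt hright hstate hq hj htT hmart hAqj
  have h𝒢t : 𝒢 t = enlargedFiltration T W X hW hX ⟨t, ht⟩ := by
    rw [← Set.projIcc_of_mem hT ht]; rfl
  rw [h𝒢t, hyX t ht] at hfinal
  rw [hexp]
  exact hfinal
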